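/- **Setting.** Fix matrix sizes $m_l\times n_l$, $1\le l\le L$, and write $\mathbf X=(X^{(1)},\dots,X^{(L)})$ with $X^{(l)}\in\mathbb R^{m_l\times n_l}$, $\|\mathbf X\|_F=(\sum_l\|X^{(l)}\|_F^2)^{1/2}$, $\|\mathbf X\|_*=\sum_l\|X^{(l)}\|_*$ (nuclear norm), $\operatorname{rank}(\mathbf X)=\max_l\operatorname{rank}(X^{(l)})$. Singular values are $\sigma_1(X)\ge\sigma_2(X)\ge\dots$, continued by $0$ beyond $\min(m_l,n_l)$, and $\sigma_0(X):=0$. Let $$f(\mathbf X)=\widehat{\mathcal L}^{\rm full}(\mathbf X)=\frac1N\sum_{i=1}^N\ell\big(\mathrm{net}(\mathbf W_0+\mathbf X;x_i),y_i\big)$$ be the empirical fine-tuning risk of a model with outputs in $\mathbb R^K$, assumed twice continuously differentiable in $\mathbf X$. For $\lambda\ge0$ put $\widehat{\mathcal L}^{\rm full}_\lambda(\mathbf X)=f(\mathbf X)+\lambda\|\mathbf X\|_*$ and, for $\mathbf A=(A^{(l)})$, $\mathbf B=(B^{(l)})$ with $A^{(l)}\in\mathbb R^{m_l\times r}$, $B^{(l)}\in\mathbb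 R^{n_l\times r}$ and $\mathbf A\mathbf B^\top=(A^{(l)}(B^{(l)})^\top)_l$, $$\widehat{\mathcal L}^{\rm lora}_\lambda(\mathbf A,\mathbf B)=f(\mathbf A\mathbf B^\top)+\tfrac\lambda2\big(\|\mathbf A\|_F^2+\|\mathbf B\|_F^2\big).$$ A second-order stationary point (SOSP) is a point with zero gradient and positive semidefinite Hessian. Given an exact global minimizer $\mathbf X_\star$ of $\widehat{\mathcal L}^{\rm full}_\lambda$, a tuple $\mathbf X$ is called an *$\varepsilon$-global minimizer* if $\|X^{(l)}-X_\star^{(l)}\|_F\le\varepsilon$ for all $l$. Let $\mathcal S=\{\mathbf X:\|\mathbf X-\mathbf X_\star\|_F\le D,\ \operatorname{rank}(\mathbf X)\le r\}$, let $\nabla_l$, $\nabla^2_{l,l}$ be the gradient and Hessian with respect to the $l$-th matrix, and let $\alpha,\beta\in\mathbb R^L$. The function $f$ is *$(\alpha,r,D)$-restricted strongly convex about $\mathbf X_\star$* if for all $l$ and all $\mathbf X\in\mathcal S$ $$\langle\nabla_lf(\mathbf X)-\nabla_lf(\mathbf X_\star),X^{(l)}-X_\star^{(l)}\rangle\ge\alpha^{(l)}\|X^{(l)}-X^{(l)}_\star\|_F^2,$$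 and *$(\beta,r,D)$-restricted smooth about $\mathbf X_\star$* if for all $l$, all $\mathbf X\in\mathcal S$ and all rank-one $U\in\mathbb R^{m_l\times m_l}$, $V\in\mathbb R^{n_l\times n_l}$ with $\|U\|_F=\|V\|_F=1$ $$\nabla^2_{l,l}f(\mathbf X)[UX^{(l)}+X^{(l)}V,\,UX^{(l)}+X^{(l)}V]\le\beta^{(l)}\|UX^{(l)}+X^{(l)}V\|_F^2.$$ **Theorem (Master Theorem).** Fix $D,R\in\mathbb R$ and a function $\delta(\cdot)$ with $\delta(\varepsilon)=o(\varepsilon^3)$ as $\varepsilon\to0^+$. There is $\varepsilon_0>0$, depending only on the sizes $(m_l,n_l)_l$, on $D$, $R$, on the function $\delta(\cdot)$ and on the data spaces, such that the following holds for every $0<\varepsilon<\varepsilon_0$, every $\lambda\ge0$, all integers $0\le r_\star\le r$, and every $f$ as above. Assume that $\widehat{\mathcal L}^{\rm full}_\lambda$ has an exact global minimizer $\mathbf X_\star$ with $\|\mathbf X_\star\|_F\le R$, and a $\delta(\varepsilon)$-global minimizer $\mathbf X_\star^{(\delta)}$ (relative to $\mathbf X_\star$) of rank at most $r_\star$. Assume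 that $f$ is $(\alpha,r,D)$-restricted strongly convex and $(\beta,r,D)$-restricted smooth about $\mathbf X_\star$ with all $\alpha^{(l)}>0$ and all $\beta^{(l)}<\infty$. Then every SOSP $(\mathbf A,\mathbf B)$ of $\widehat{\mathcal L}^{\rm lora}_\lambda$ with $\mathbf X_\square=\mathbf A\mathbf B^\top$ and $\|\mathbf X_\square-\mathbf X_\star\|_F\le D$ satisfies: 1. (special regime) If $2\alpha^{(l)}\ge\beta^{(l)}(1+\varepsilon)$ for all $l$, then $\mathbf X_\square$ is an $\varepsilon$-global minimizer. 2. (generic regime) If $2\alpha^{(l)}<\beta^{(l)}(1+\varepsilon)$ for some $l$, then one of the following holds. * (i) $\mathbf X_\square$ is an $\varepsilon$-global minimizer. * (ii) $\mathbf X_\square$ is not an $\varepsilon$-global minimizer, and for some $l$ with $2\alpha^{(l)}<\beta^{(l)}(1+\varepsilon)$ the matrix $X=X_\square^{(l)}$ has rank exactly $r$, $$\sigma_r(X)\ge\max\Big\{\frac{2\alpha^{(l)}}{\beta^{(l)}(1+\varepsilon)}\sigma_{r_\star}(X),\ \frac{\alpha^{(l)}}{2\beta^{(l)}\sqrt r}\,\varepsilon\Big\},$$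 and either $\sigma_r(X)\le\frac{2\alpha^{(l)}}{\beta^{(l)}}\sigma_{r_\star}(X)$ or $$\|X-X_\star^{(l)}\|_F\ \ge\ \sqrt{\frac{\|X-\Pi_{\mathrm{rank}\le r_\star}(X)\|_F^2-\varepsilon^3}{1-\frac{2\alpha^{(l)}\sigma_{r_\star}(X)}{\beta^{(l)}\sigma_r(X)}}}-\varepsilon^2,$$ where $\Pi_{\mathrm{rank}\le r_\star}(X)$ is a Frobenius-norm projection of $X$ onto the matrices of rank at most $r_\star$, and the square root of a negative number is read as $0$. -/

import Mathlib

open Filter Topology Asymptotics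

attribute [local instance] Matrix.frobeniusNormedAddCommGroup Matrix.frobeniusNormedSpace

namespace LoRA

variable {L : ℕ}

/-- Tuples `(X⁽¹⁾, …, X⁽ᴸ⁾)` with `X⁽ˡ⁾` a real `m l × n l` matrix. Each matrix space carries the
Frobenius norm. -/
abbrev MatTuple (m n : Fin L → ℕ) : Type := ∀ l, Matrix (Fin (m l)) (Fin (n l)) ℝ

/-- The singular values `σ₁(X) ≥ σ₂(X) ≥ …`, indexed from `1` and continued by `0`, with the
convention `σ₀(X) = 0`. -/
noncomputable def sval {p q : ℕ} (X : Matrix (Fin p) (Fin q) ℝ) : ℕ → ℝ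
  | 0 => 0
  | k + 1 => (Matrix.toEuclideanLin X).singularValues k

/-- The nuclear norm, i.e. the sum of the singular values. -/
noncomputable def nuclearNorm {p q : ℕ} (X : Matrix (Fin p) (Fin q) ℝ) : ℝ :=
  ∑ k ∈ Finset.range q, sval X (k + 1)

/-- The matrix inner product `⟨A, B⟩ = tr (Aᵀ B)`. -/
def frobInner {p q : ℕ} (A B : Matrix (Fin p) (Fin q) ℝ) : ℝ := (A.transpose * B).trace

/-- `P` is a projection (in Frobenius norm) of `X` onto the matrices of rank at most `k`. -/
def IsRankProj {p q : ℕ} (k : ℕ) (X P : Matrix (Fin p) (Fin q) ℝ) : Prop :=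
  P.rank ≤ k ∧ ∀ Q : Matrix (Fin p) (Fin q) ℝ, Q.rank ≤ k → ‖X - P‖ ≤ ‖X - Q‖

/-- The Frobenius norm of a tuple, `‖X‖_F = (∑ l, ‖X⁽ˡ⁾‖_F²)^(1/2)`. -/
noncomputable def tupleNorm {m n : Fin L → ℕ} (X : MatTuple m n) : ℝ :=
  Real.sqrt (∑ l, ‖X l‖ ^ 2)

/-- The rank of a tuple, `max_l rank X⁽ˡ⁾`. -/
noncomputable def tupleRank {m n : Fin L → ℕ} (X : MatTuple m n) : ℕ :=
  Finset.univ.sup fun l => (X l).rank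

/-- The tuple `A Bᵀ = (A⁽ˡ⁾ (B⁽ˡ⁾)ᵀ)_l`. -/
def lowRankProd {m n : Fin L → ℕ} {r : ℕ}
    (A : MatTuple m fun _ => r) (B : MatTuple n fun _ => r) : MatTuple m n :=
  fun l => A l * (B l).transpose

/-- The empirical risk of full fine-tuning,
`X ↦ (1/N) ∑ i, ℓ (f (W₀ + X; x i), y i)`. -/
noncomputable def fullLoss {m n : Fin L → ℕ} {𝒳 𝒴 : Type*} {K N : ℕ}
    (net : MatTuple m n → 𝒳 → EuclideanSpace ℝ (Fin K)) (W₀ : MatTuple m n)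
    (loss : EuclideanSpace ℝ (Fin K) → 𝒴 → ℝ) (x : Fin N → 𝒳) (y : Fin N → 𝒴)
    (X : MatTuple m n) : ℝ :=
  (1 / (N : ℝ)) * ∑ i, loss (net (W₀ + X) (x i)) (y i)

/-- Nuclear norm regularization of a full fine-tuning loss. -/
noncomputable def regFullLoss {m n : Fin L → ℕ} (f : MatTuple m n → ℝ) (lam : ℝ)
    (X : MatTuple m n) : ℝ :=
  f X + lam * ∑ l, nuclearNorm (X l)

/-- The rank-`r` LoRA loss with weight decay,
`(A, B) ↦ f (A Bᵀ) + (λ/2) (‖A‖_F² + ‖B‖_F²)`. -/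
noncomputable def regLoraLoss {m n : Fin L → ℕ} (f : MatTuple m n → ℝ) (lam : ℝ) (r : ℕ)
    (p : MatTuple m (fun _ => r) × MatTuple n (fun _ => r)) : ℝ :=
  f (lowRankProd p.1 p.2) + lam / 2 * (tupleNorm p.1 ^ 2 + tupleNorm p.2 ^ 2)

/-- Second-order stationary points: vanishing gradient and positive semidefinite Hessian. -/
def IsSOSP {E : Type*} [NormedAddCommGroup E] [NormedSpace ℝ E] (g : E → ℝ) (p : E) : Prop :=
  fderiv ℝ g p = 0 ∧ ∀ u : E, 0 ≤ iteratedFDeriv ℝ 2 g p ![u, u]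

/-- The gradient `∇_l f (X)` with respect to the `l`-th matrix, as a matrix of partial
derivatives. -/
noncomputable def blockGrad {m n : Fin L → ℕ} (f : MatTuple m n → ℝ) (l : Fin L)
    (X : MatTuple m n) : Matrix (Fin (m l)) (Fin (n l)) ℝ :=
  Matrix.of fun i j => fderiv ℝ f X (Pi.single l (Matrix.single i j (1 : ℝ)))

/-- The quadratic form `∇²_{l,l} f (X) [H, H]` of the Hessian with respect to the `l`-th
matrix. -/
noncomputable def blockHess {m n : Fin L → ℕ} (f : MatTuple m n → ℝ) (l : Fin L)
    (X : MatTuple m n) (H : Matrix (Fin (m l)) (Fin (n l)) ℝ) : ℝ :=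
  iteratedFDeriv ℝ 2 f X ![Pi.single l H, Pi.single l H]

/-- `f` is `(α, r, D)`-restricted strongly convex about `Xs`. -/
def IsRSC {m n : Fin L → ℕ} (f : MatTuple m n → ℝ) (Xs : MatTuple m n) (r : ℕ) (D : ℝ)
    (α : Fin L → ℝ) : Prop :=
  ∀ l, ∀ X : MatTuple m n, tupleNorm (X - Xs) ≤ D → tupleRank X ≤ r →
    α l * ‖X l - Xs l‖ ^ 2 ≤ frobInner (blockGrad f l X - blockGrad f l Xs) (X l - Xs l)

/-- `f` is `(β, r, D)`-restricted smooth about `Xs`. -/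
def IsRSM {m n : Fin L → ℕ} (f : MatTuple m n → ℝ) (Xs : MatTuple m n) (r : ℕ) (D : ℝ)
    (β : Fin L → ℝ) : Prop :=
  ∀ l, ∀ X : MatTuple m n, tupleNorm (X - Xs) ≤ D → tupleRank X ≤ r →
    ∀ (U : Matrix (Fin (m l)) (Fin (m l)) ℝ) (V : Matrix (Fin (n l)) (Fin (n l)) ℝ),
      U.rank = 1 → ‖U‖ = 1 → V.rank = 1 → ‖V‖ = 1 →
        blockHess f l X (U * X l + X l * V) ≤ β l * ‖U * X l + X l * V‖ ^ 2

/-- `Xs` is an exact global minimizer of `F`. -/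
def IsGlobalMin {m n : Fin L → ℕ} (F : MatTuple m n → ℝ) (Xs : MatTuple m n) : Prop :=
  ∀ X, F Xs ≤ F X

/-- `X` is an `ε`-global minimizer of `F`, witnessed by the exact global minimizer `Xs`. -/
def IsApproxGlobalMin {m n : Fin L → ℕ} (F : MatTuple m n → ℝ) (Xs : MatTuple m n) (ε : ℝ)
    (X : MatTuple m n) : Prop :=
  IsGlobalMin F Xs ∧ ∀ l, ‖X l - Xs l‖ ≤ ε

end LoRA

/-! The argument runs one layer at a time. Write `X` for the layer of the stationary product, `G`
for the block gradient of `f` there, `Xs` for the layer of the minimizer and `d = ‖X - Xs‖`.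
Stationarity makes `A` and `B` balanced (when `lam > 0`), so each singular pair `(u, v)` of `X` with
positive singular value satisfies `G v = -lam u` and `Gᵀ u = -lam v`. Hence `-G` agrees with `lam`
times the polar factor `W` of `X`, up to a part `N` orthogonal to `X` on both sides. The question is
how large `N` can be.

If `rank X < r`, perturbing `A` and `B` along a spare direction gives `‖G‖ ≤ lam` in operator norm,
so `-G` is `lam` times a subgradient of the nuclear norm at `X`
(`frobInner_grad_sub_le_of_rank_lt`). Together with first-order optimality of `Xs`
(`IsGlobalMin.neg_le`) and restricted strong convexity this forces `d = 0`.

If `rank X = r`, the perturbation must go through the weakest singular pair, and curvature costs an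
extra `β σ_r`: `-G = lam (W + E) + β σ_r E` with a contraction `E` orthogonal to `X`
(`exists_contraction_of_rank_eq`). The same comparison now yields `α d² ≤ β σ_r ⟨E, Xs⟩`. In the
other direction, a sharpened Eckart–Young inequality (`norm_sub_sq_ge`) says that a matrix `Y` of
rank at most `s` correlated with `E` must be far from `X`: `‖X - Y‖² ≥ ‖X - Π_s X‖² + 2 σ_s ⟨E, Y⟩`.
Taking for `Y` the approximate minimizer and eliminating the correlation gives `‖X - Π_s X‖² ≤ (1 -
c) d²` up to `ε³`, with `c = 2 α σ_s / (β σ_r)`. All claims for a layer with `d > ε` are read off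
from this inequality and from `⟨E, Y⟩ = ⟨E, Y - X⟩` (`estimates_of_rank_eq`). -/

namespace LoRA

open Matrix

section LinearAlgebra

variable {p q : ℕ}

/-! ### The Frobenius inner product -/

theorem frobInner_eq_sum (M N : Matrix (Fin p) (Fin q) ℝ) :
    frobInner M N = ∑ i, ∑ j, M i j * N i j := by
  simp only [frobInner, Matrix.trace, Matrix.diag, Matrix.mul_apply, Matrix.transpose_apply]
  exact Finset.sum_comm

theorem norm_sq_eq_frobInner (M : Matrix (Fin p) (Fin q) ℝ) : ‖M‖ ^ 2 = frobInner M M := by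
  rw [Matrix.frobenius_norm_def, ← Real.sqrt_eq_rpow, Real.sq_sqrt (by positivity),
    frobInner_eq_sum]
  simp [pow_two]

theorem frobInner_comm (M N : Matrix (Fin p) (Fin q) ℝ) : frobInner M N = frobInner N M := by
  simp only [frobInner_eq_sum, mul_comm]

theorem frobInner_add_left (M N K : Matrix (Fin p) (Fin q) ℝ) :
    frobInner (M + N) K = frobInner M K + frobInner N K := by
  simp [frobInner, Matrix.add_mul]

theorem frobInner_add_right (M N K : Matrix (Fin p) (Fin q) ℝ) :
    frobInner K (M + N) = frobInner K M + frobInner K N := by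
  simp [frobInner, Matrix.mul_add]

theorem frobInner_sub_left (M N K : Matrix (Fin p) (Fin q) ℝ) :
    frobInner (M - N) K = frobInner M K - frobInner N K := by
  simp [frobInner, Matrix.sub_mul]

theorem frobInner_sub_right (M N K : Matrix (Fin p) (Fin q) ℝ) :
    frobInner K (M - N) = frobInner K M - frobInner K N := by
  simp [frobInner, Matrix.mul_sub]

theorem frobInner_neg_left (M K : Matrix (Fin p) (Fin q) ℝ) :
    frobInner (-M) K = -frobInner M K := by
  simp [frobInner]

theorem frobInner_smul_left (c : ℝ) (M K : Matrix (Fin p) (Fin q) ℝ) :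
    frobInner (c • M) K = c * frobInner M K := by
  simp [frobInner]

theorem frobInner_smul_right (c : ℝ) (M K : Matrix (Fin p) (Fin q) ℝ) :
    frobInner K (c • M) = c * frobInner K M := by
  simp [frobInner]

theorem frobInner_vecMulVec (M : Matrix (Fin p) (Fin q) ℝ) (a : Fin p → ℝ) (b : Fin q → ℝ) :
    frobInner M (vecMulVec a b) = a ⬝ᵥ (M *ᵥ b) := by
  simp only [frobInner_eq_sum, vecMulVec_apply, dotProduct, mulVec, Finset.mul_sum]
  exact Finset.sum_congr rfl fun i _ => Finset.sum_congr rfl fun j _ => by ring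

theorem dotProduct_self_nonneg' {ι : Type*} [Fintype ι] (a : ι → ℝ) : 0 ≤ a ⬝ᵥ a :=
  Finset.sum_nonneg fun i _ => mul_self_nonneg (a i)

theorem dotProduct_le_sqrt_mul_sqrt {ι : Type*} [Fintype ι] (a b : ι → ℝ) :
    a ⬝ᵥ b ≤ √(a ⬝ᵥ a) * √(b ⬝ᵥ b) := by
  have := Real.sum_mul_le_sqrt_mul_sqrt Finset.univ a b
  simpa [dotProduct, pow_two] using this

theorem mulVec_dotProduct (M : Matrix (Fin p) (Fin q) ℝ) (b : Fin q → ℝ) (a : Fin p → ℝ) :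
    (M *ᵥ b) ⬝ᵥ a = b ⬝ᵥ (Mᵀ *ᵥ a) := by
  rw [dotProduct_comm, dotProduct_mulVec, ← mulVec_transpose, dotProduct_comm]

/-! ### Orthonormal bases -/

/-- The vectors `v j` form an orthonormal basis. -/
def IsONB (v : Fin q → Fin q → ℝ) : Prop := ∀ i j, v i ⬝ᵥ v j = if i = j then 1 else 0

theorem IsONB.dotProduct_eq_sum {v : Fin q → Fin q → ℝ} (hv : IsONB v) (a b : Fin q → ℝ) :
    a ⬝ᵥ b = ∑ j, (v j ⬝ᵥ a) * (v j ⬝ᵥ b) := by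
  have h1 : (Matrix.of v) * (Matrix.of v)ᵀ = 1 := by
    ext i j
    simpa [Matrix.mul_apply, dotProduct, Matrix.one_apply] using hv i j
  have h2 : (Matrix.of v)ᵀ * (Matrix.of v) = 1 := mul_eq_one_comm.mp h1
  have h3 : ((Matrix.of v) *ᵥ a) ⬝ᵥ ((Matrix.of v) *ᵥ b) = a ⬝ᵥ b := by
    rw [mulVec_dotProduct, mulVec_mulVec, h2, one_mulVec]
  rw [← h3]
  rfl

theorem IsONB.eq_sum {v : Fin q → Fin q → ℝ} (hv : IsONB v) (a : Fin q → ℝ) :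
    a = ∑ j, (v j ⬝ᵥ a) • v j := by
  ext i
  have := hv.dotProduct_eq_sum (Pi.single i 1) a
  simp only [single_one_dotProduct, dotProduct_single_one] at this
  rw [this, Finset.sum_apply]
  exact Finset.sum_congr rfl fun j _ => by simp [mul_comm]

theorem IsONB.frobInner_eq_sum {v : Fin q → Fin q → ℝ} (hv : IsONB v)
    (M N : Matrix (Fin p) (Fin q) ℝ) :
    frobInner M N = ∑ j, (M *ᵥ v j) ⬝ᵥ (N *ᵥ v j) := by
  rw [LoRA.frobInner_eq_sum]
  have : ∀ i, ∑ j, M i j * N i j = ∑ j, (v j ⬝ᵥ M i) * (v j ⬝ᵥ N i) := fun i =>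
    hv.dotProduct_eq_sum (M i) (N i)
  simp only [this]
  rw [Finset.sum_comm]
  refine Finset.sum_congr rfl fun j _ => Finset.sum_congr rfl fun i _ => ?_
  simp only [mulVec, dotProduct_comm]

theorem IsONB.norm_sq_eq_sum {v : Fin q → Fin q → ℝ} (hv : IsONB v)
    (M : Matrix (Fin p) (Fin q) ℝ) : ‖M‖ ^ 2 = ∑ j, (M *ᵥ v j) ⬝ᵥ (M *ᵥ v j) := by
  rw [norm_sq_eq_frobInner, hv.frobInner_eq_sum]

/-! ### Singular values and singular bases -/

theorem sval_nonneg (X : Matrix (Fin p) (Fin q) ℝ) (k : ℕ) : 0 ≤ sval X k := by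
  cases k with
  | zero => exact le_rfl
  | succ k => exact LinearMap.singularValues_nonneg _ k

theorem sval_le_sval (X : Matrix (Fin p) (Fin q) ℝ) {i j : ℕ} (hi : 1 ≤ i) (hij : i ≤ j) :
    sval X j ≤ sval X i := by
  obtain ⟨i, rfl⟩ := Nat.exists_eq_add_of_le' hi
  obtain ⟨j, rfl⟩ := Nat.exists_eq_add_of_le' (hi.trans hij)
  exact LinearMap.singularValues_antitone _ (by omega)

/-- Bridges the one-based `sval` and the zero-based library indexing; rank hypotheses become
positivity of singular values through it. -/
theorem sval_succ_pos_iff (X : Matrix (Fin p) (Fin q) ℝ) (k : ℕ) :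
    0 < sval X (k + 1) ↔ k < X.rank := by
  rw [sval, LinearMap.singularValues_pos_iff_lt_finrank_range, Matrix.rank_eq_finrank_range_toLin X
    (EuclideanSpace.basisFun _ ℝ).toBasis (EuclideanSpace.basisFun _ ℝ).toBasis,
    Matrix.toEuclideanLin_eq_toLin_orthonormal]

/-- The vectors `v j` form an orthonormal basis of right singular vectors of `X`, ordered by
decreasing singular values. -/
structure IsRightSingularBasis (X : Matrix (Fin p) (Fin q) ℝ) (v : Fin q → Fin q → ℝ) : Prop where
  onb : IsONB v
  eigen : ∀ j : Fin q, Xᵀ *ᵥ (X *ᵥ v j) = sval X (j + 1) ^ 2 • v j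

theorem exists_isRightSingularBasis (X : Matrix (Fin p) (Fin q) ℝ) :
    ∃ v, IsRightSingularBasis X v := by
  have hn : Module.finrank ℝ (EuclideanSpace ℝ (Fin q)) = q := by simp
  set T := Matrix.toEuclideanLin X with hT
  set b := T.isSymmetric_adjoint_comp_self.eigenvectorBasis hn
  refine ⟨fun j => (b j).ofLp, fun i j => ?_, fun j => ?_⟩
  · have := orthonormal_iff_ite.mp b.orthonormal i j
    rw [← this, dotProduct_comm]
    rfl
  · have h1 := T.isSymmetric_adjoint_comp_self.apply_eigenvectorBasis hn j
    rw [← T.sq_singularValues_fin hn j] at h1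
    have h2 : LinearMap.adjoint T = Matrix.toEuclideanLin Xᵀ := by
      rw [hT, ← Matrix.conjTranspose_eq_transpose_of_trivial,
        Matrix.toEuclideanLin_conjTranspose_eq_adjoint]
    rw [LinearMap.comp_apply, LinearMap.congr_fun h2] at h1
    exact congrArg WithLp.ofLp h1

namespace IsRightSingularBasis

variable {X : Matrix (Fin p) (Fin q) ℝ} {v : Fin q → Fin q → ℝ}

theorem mulVec_dotProduct_mulVec (hv : IsRightSingularBasis X v) (i j : Fin q) :
    (X *ᵥ v i) ⬝ᵥ (X *ᵥ v j) = if i = j then sval X (j + 1) ^ 2 else 0 := by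
  rw [mulVec_dotProduct, hv.eigen, dotProduct_smul, hv.onb]
  simp

theorem mulVec_eq_zero (hv : IsRightSingularBasis X v) {j : Fin q} (h : sval X (j + 1) = 0) :
    X *ᵥ v j = 0 := by
  have := hv.mulVec_dotProduct_mulVec j j
  rw [if_pos rfl, h] at this
  exact dotProduct_self_eq_zero.mp (by simpa using this)

theorem mulVec_eq_zero_of_rank_le (hv : IsRightSingularBasis X v) {j : Fin q} (h : X.rank ≤ j) :
    X *ᵥ v j = 0 := by
  refine hv.mulVec_eq_zero (le_antisymm (not_lt.mp fun h' => ?_) (sval_nonneg _ _))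
  exact absurd ((sval_succ_pos_iff X j).mp h') (by omega)

theorem norm_sq_eq (hv : IsRightSingularBasis X v) :
    ‖X‖ ^ 2 = ∑ j : Fin q, sval X (j + 1) ^ 2 := by
  rw [hv.onb.norm_sq_eq_sum]
  exact Finset.sum_congr rfl fun j _ => by rw [hv.mulVec_dotProduct_mulVec, if_pos rfl]

theorem mulVec_dotProduct_mulVec_self (hv : IsRightSingularBasis X v) (w : Fin q → ℝ) :
    (X *ᵥ w) ⬝ᵥ (X *ᵥ w) = ∑ j : Fin q, sval X (j + 1) ^ 2 * (v j ⬝ᵥ w) ^ 2 := by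
  rw [mulVec_dotProduct, hv.onb.dotProduct_eq_sum]
  refine Finset.sum_congr rfl fun j _ => ?_
  have : v j ⬝ᵥ (Xᵀ *ᵥ (X *ᵥ w)) = sval X (j + 1) ^ 2 * (v j ⬝ᵥ w) := by
    rw [← mulVec_dotProduct, dotProduct_comm, mulVec_dotProduct, hv.eigen, dotProduct_smul,
      dotProduct_comm, smul_eq_mul]
  rw [this]; ring

end IsRightSingularBasis

theorem sval_le_norm (X : Matrix (Fin p) (Fin q) ℝ) (k : ℕ) : sval X k ≤ ‖X‖ := by
  rcases (sval_nonneg X k).eq_or_lt with h | h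
  · rw [← h]; positivity
  cases k with
  | zero => exact absurd h (lt_irrefl _)
  | succ k =>
    obtain ⟨v, hv⟩ := exists_isRightSingularBasis X
    have hk : k < q := ((sval_succ_pos_iff X k).mp h).trans_le (X.rank_le_width)
    refine le_of_sq_le_sq ?_ (norm_nonneg _)
    rw [hv.norm_sq_eq]
    exact Finset.single_le_sum (f := fun j : Fin q => sval X (j + 1) ^ 2)
      (fun j _ => sq_nonneg _) (Finset.mem_univ (⟨k, hk⟩ : Fin q))

/-! ### Operator norm bounds and duality -/

/-- The operator norm of `M` is at most `|c|`. -/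
def OpLe (M : Matrix (Fin p) (Fin q) ℝ) (c : ℝ) : Prop :=
  ∀ b, (M *ᵥ b) ⬝ᵥ (M *ᵥ b) ≤ c ^ 2 * (b ⬝ᵥ b)

theorem nuclearNorm_eq (X : Matrix (Fin p) (Fin q) ℝ) :
    nuclearNorm X = ∑ j : Fin q, sval X (j + 1) := by
  rw [nuclearNorm, Finset.sum_range]

theorem OpLe.mulVec_dotProduct_le {W X : Matrix (Fin p) (Fin q) ℝ} {c : ℝ} (hW : OpLe W c)
    (hc : 0 ≤ c) {v : Fin q → Fin q → ℝ} (hv : IsRightSingularBasis X v) (j : Fin q) :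
    (W *ᵥ v j) ⬝ᵥ (X *ᵥ v j) ≤ c * sval X (j + 1) := by
  refine (dotProduct_le_sqrt_mul_sqrt _ _).trans ?_
  rw [hv.mulVec_dotProduct_mulVec, if_pos rfl, Real.sqrt_sq (sval_nonneg _ _)]
  refine mul_le_mul_of_nonneg_right ?_ (sval_nonneg _ _)
  refine Real.sqrt_le_iff.mpr ⟨hc, (hW _).trans_eq ?_⟩
  rw [hv.onb, if_pos rfl, mul_one]

theorem OpLe.frobInner_le_nuclearNorm {W : Matrix (Fin p) (Fin q) ℝ} {c : ℝ} (hW : OpLe W c)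
    (hc : 0 ≤ c) (X : Matrix (Fin p) (Fin q) ℝ) : frobInner W X ≤ c * nuclearNorm X := by
  obtain ⟨v, hv⟩ := exists_isRightSingularBasis X
  rw [nuclearNorm_eq, hv.onb.frobInner_eq_sum, Finset.mul_sum]
  exact Finset.sum_le_sum fun j _ => hW.mulVec_dotProduct_le hc hv j

theorem card_filter_val_lt_le (k : ℕ) :
    (Finset.univ.filter fun j : Fin q => (j : ℕ) < k).card ≤ k := by
  have : (Finset.univ.filter fun j : Fin q => (j : ℕ) < k).card ≤ (Finset.range k).card :=
    Finset.card_le_card_of_injOn (fun j => (j : ℕ)) (fun j hj => by simpa using hj)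
      fun a _ b _ h => Fin.ext h
  simpa using this

/-- In a right singular basis of `M` only the first `k` terms of the trace survive, each at most a
singular value of `M`; Cauchy–Schwarz over these terms gives the factor `√k`. -/
theorem OpLe.frobInner_le_of_rank_le {E : Matrix (Fin p) (Fin q) ℝ} (hE : OpLe E 1)
    {M : Matrix (Fin p) (Fin q) ℝ} {k : ℕ} (hM : M.rank ≤ k) : frobInner E M ≤ √k * ‖M‖ := by
  obtain ⟨v, hv⟩ := exists_isRightSingularBasis M
  set F : Finset (Fin q) := (Finset.univ.filter fun j : Fin q => (j : ℕ) < k) with hF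
  have h1 : frobInner E M = ∑ j ∈ F, (E *ᵥ v j) ⬝ᵥ (M *ᵥ v j) := by
    rw [hv.onb.frobInner_eq_sum]
    refine (Finset.sum_subset (Finset.subset_univ F) fun j _ hj => ?_).symm
    rw [hv.mulVec_eq_zero_of_rank_le (by simp [F] at hj; omega), dotProduct_zero]
  rw [h1]
  refine (Finset.sum_le_sum fun j _ => hE.mulVec_dotProduct_le zero_le_one hv j).trans
    ((Real.sum_mul_le_sqrt_mul_sqrt F _ _).trans ?_)
  refine mul_le_mul (Real.sqrt_le_sqrt ?_) ?_ (by positivity) (by positivity)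
  · simpa only [one_pow, Finset.sum_const, nsmul_eq_mul, mul_one, Nat.cast_le] using
      card_filter_val_lt_le (q := q) k
  · refine Real.sqrt_le_iff.mpr ⟨norm_nonneg _, ?_⟩
    rw [hv.norm_sq_eq]
    exact Finset.sum_le_sum_of_subset_of_nonneg (Finset.subset_univ F) fun _ _ _ => sq_nonneg _

/-- The polar factor `∑ j, u j (v j)ᵀ` of `X`, where `u j = (σ j)⁻¹ X v j`. -/
noncomputable def polarFactor (X : Matrix (Fin p) (Fin q) ℝ) (v : Fin q → Fin q → ℝ) :
    Matrix (Fin p) (Fin q) ℝ :=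
  X * ∑ j : Fin q, (sval X (j + 1))⁻¹ • vecMulVec (v j) (v j)

namespace IsRightSingularBasis

variable {X : Matrix (Fin p) (Fin q) ℝ} {v : Fin q → Fin q → ℝ}

theorem polarFactor_mulVec (hv : IsRightSingularBasis X v) (i : Fin q) :
    polarFactor X v *ᵥ v i = (sval X (i + 1))⁻¹ • (X *ᵥ v i) := by
  rw [polarFactor, ← mulVec_mulVec, Matrix.sum_mulVec, Finset.sum_eq_single i]
  · rw [smul_mulVec, vecMulVec_mulVec, hv.onb, if_pos rfl]
    simp [mulVec_smul]
  · intro j _ hj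
    rw [smul_mulVec, vecMulVec_mulVec, hv.onb, if_neg hj]
    simp
  · simp

theorem frobInner_polarFactor (hv : IsRightSingularBasis X v) :
    frobInner (polarFactor X v) X = nuclearNorm X := by
  rw [nuclearNorm_eq, hv.onb.frobInner_eq_sum]
  refine Finset.sum_congr rfl fun j _ => ?_
  rw [hv.polarFactor_mulVec, smul_dotProduct, hv.mulVec_dotProduct_mulVec, if_pos rfl, smul_eq_mul]
  rcases eq_or_ne (sval X (j + 1)) 0 with h | h
  · simp [h]
  · field_simp

/-- The convention `0⁻¹ = 0` makes the polar factor a partial isometry: it kills the kernel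
directions of `X` and is isometric on the others. -/
theorem polarFactor_mulVec_dotProduct_self (hv : IsRightSingularBasis X v) (b : Fin q → ℝ) :
    (polarFactor X v *ᵥ b) ⬝ᵥ (polarFactor X v *ᵥ b) =
      ∑ j : Fin q, if sval X (j + 1) = 0 then 0 else (v j ⬝ᵥ b) ^ 2 := by
  rw [polarFactor, ← mulVec_mulVec, hv.mulVec_dotProduct_mulVec_self]
  refine Finset.sum_congr rfl fun j _ => ?_
  have : v j ⬝ᵥ ((∑ j : Fin q, (sval X (j + 1))⁻¹ • vecMulVec (v j) (v j)) *ᵥ b) =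
      (sval X (j + 1))⁻¹ * (v j ⬝ᵥ b) := by
    rw [Matrix.sum_mulVec, dotProduct_sum, Finset.sum_eq_single j]
    · rw [smul_mulVec, vecMulVec_mulVec]
      simp [hv.onb j j]
    · intro i _ hi
      rw [smul_mulVec, vecMulVec_mulVec]
      simp [hv.onb j i, hi.symm]
    · simp
  rw [this]
  split_ifs with h
  · simp [h]
  · field_simp

theorem opLe_polarFactor (hv : IsRightSingularBasis X v) : OpLe (polarFactor X v) 1 := fun b => by
  rw [hv.polarFactor_mulVec_dotProduct_self, hv.onb.dotProduct_eq_sum b b, one_pow, one_mul]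
  refine Finset.sum_le_sum fun j _ => ?_
  split_ifs
  · exact mul_self_nonneg _
  · rw [pow_two]

end IsRightSingularBasis

/-- Duality: the polar factor of the combination is a contraction that attains its nuclear norm, and
it tests `X` and `Y` no better than their own nuclear norms. -/
theorem nuclearNorm_smul_add_smul_le (X Y : Matrix (Fin p) (Fin q) ℝ) {s t : ℝ} (hs : 0 ≤ s)
    (ht : 0 ≤ t) : nuclearNorm (s • X + t • Y) ≤ s * nuclearNorm X + t * nuclearNorm Y := by
  obtain ⟨v, hv⟩ := exists_isRightSingularBasis (s • X + t • Y)
  have h := hv.opLe_polarFactor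
  rw [← hv.frobInner_polarFactor, frobInner_add_right, frobInner_smul_right, frobInner_smul_right]
  have h1 := h.frobInner_le_nuclearNorm zero_le_one X
  have h2 := h.frobInner_le_nuclearNorm zero_le_one Y
  rw [one_mul] at h1 h2
  gcongr

/-- The component of `b` along the right singular vectors of `X` with singular value zero. -/
noncomputable def kerPart (X : Matrix (Fin p) (Fin q) ℝ) (v : Fin q → Fin q → ℝ) (b : Fin q → ℝ) :
    Fin q → ℝ :=
  ∑ j : Fin q, (if sval X (j + 1) = 0 then v j ⬝ᵥ b else 0) • v j

theorem IsONB.dotProduct_kerPart {v : Fin q → Fin q → ℝ} (hv : IsONB v)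
    (X : Matrix (Fin p) (Fin q) ℝ) (b : Fin q → ℝ) (i : Fin q) :
    v i ⬝ᵥ kerPart X v b = if sval X (i + 1) = 0 then v i ⬝ᵥ b else 0 := by
  rw [kerPart, dotProduct_sum, Finset.sum_eq_single i]
  · rw [dotProduct_smul, hv, if_pos rfl, smul_eq_mul, mul_one]
  · intro j _ hj
    rw [dotProduct_smul, hv, if_neg hj.symm, smul_zero]
  · simp

theorem IsONB.kerPart_dotProduct_self {v : Fin q → Fin q → ℝ} (hv : IsONB v)
    (X : Matrix (Fin p) (Fin q) ℝ) (b : Fin q → ℝ) :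
    kerPart X v b ⬝ᵥ kerPart X v b =
      ∑ j : Fin q, if sval X (j + 1) = 0 then (v j ⬝ᵥ b) ^ 2 else 0 := by
  rw [hv.dotProduct_eq_sum]
  refine Finset.sum_congr rfl fun j _ => ?_
  rw [hv.dotProduct_kerPart]
  split_ifs
  · rw [pow_two]
  · rw [mul_zero]

theorem IsONB.mulVec_kerPart {v : Fin q → Fin q → ℝ} (hv : IsONB v)
    {X E : Matrix (Fin p) (Fin q) ℝ} (hE : ∀ j : Fin q, sval X (j + 1) ≠ 0 → E *ᵥ v j = 0)
    (b : Fin q → ℝ) : E *ᵥ kerPart X v b = E *ᵥ b := by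
  conv_rhs => rw [hv.eq_sum b]
  rw [kerPart, Matrix.mulVec_sum, Matrix.mulVec_sum]
  refine Finset.sum_congr rfl fun j _ => ?_
  split_ifs with h
  · rfl
  · rw [mulVec_smul, mulVec_smul, hE j h, smul_zero, smul_zero]

/-! ### Low-rank approximation -/

/-- Eckart–Young applied to `Z = X + σ_s E` instead of `X`. Since `E` is a contraction orthogonal to
`X` on both sides, it only adds singular values at most `σ_s`, so the `s` largest of `Z` are those
of `X`. Expanding `‖Z - Y‖²` then produces the correlation term. For `E = 0` this is the usual lower
bound. -/
theorem IsRightSingularBasis.norm_sub_sq_ge {X : Matrix (Fin p) (Fin q) ℝ} {v : Fin q → Fin q → ℝ}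
    (hv : IsRightSingularBasis X v) {E : Matrix (Fin p) (Fin q) ℝ} (hE : OpLe E 1)
    (hEv : ∀ j : Fin q, sval X (j + 1) ≠ 0 → E *ᵥ v j = 0) (hXE : Xᵀ * E = 0)
    {Y : Matrix (Fin p) (Fin q) ℝ} {s : ℕ} (hY : Y.rank ≤ s) :
    ‖X‖ ^ 2 - ∑ j ∈ (Finset.univ.filter fun j : Fin q => (j : ℕ) < s), sval X (j + 1) ^ 2
      + 2 * sval X s * frobInner E Y ≤ ‖X - Y‖ ^ 2 := by
  obtain ⟨w, hw⟩ := exists_isRightSingularBasis Y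
  set t := sval X s with ht
  set Z := X + t • E with hZ
  set F : Finset (Fin q) := (Finset.univ.filter fun j : Fin q => (j : ℕ) < s) with hF
  have hXE0 : frobInner X E = 0 := by rw [frobInner, hXE, Matrix.trace_zero]
  have h1 : ‖Z - Y‖ ^ 2 = ‖X - Y‖ ^ 2 + t ^ 2 * ‖E‖ ^ 2 - 2 * t * frobInner E Y := by
    have e : Z - Y = (X - Y) + t • E := by rw [hZ]; abel
    simp only [e, norm_sq_eq_frobInner, frobInner_add_left, frobInner_add_right,
      frobInner_smul_left, frobInner_smul_right, frobInner_sub_left, frobInner_sub_right,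
      frobInner_comm E X, frobInner_comm Y E, hXE0]
    ring
  have h2 : ‖Z‖ ^ 2 = ‖X‖ ^ 2 + t ^ 2 * ‖E‖ ^ 2 := by
    simp only [hZ, norm_sq_eq_frobInner, frobInner_add_left, frobInner_add_right,
      frobInner_smul_left, frobInner_smul_right, frobInner_comm E X, hXE0]
    ring
  have h3 : ‖Z‖ ^ 2 - ∑ k ∈ F, (Z *ᵥ w k) ⬝ᵥ (Z *ᵥ w k) ≤ ‖Z - Y‖ ^ 2 := by
    rw [hw.onb.norm_sq_eq_sum Z, hw.onb.norm_sq_eq_sum (Z - Y),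
      ← Finset.sum_add_sum_compl F (fun j => (Z *ᵥ w j) ⬝ᵥ (Z *ᵥ w j)), add_sub_cancel_left]
    calc ∑ i ∈ Fᶜ, (Z *ᵥ w i) ⬝ᵥ (Z *ᵥ w i)
        = ∑ i ∈ Fᶜ, ((Z - Y) *ᵥ w i) ⬝ᵥ ((Z - Y) *ᵥ w i) := by
          refine Finset.sum_congr rfl fun i hi => ?_
          rw [sub_mulVec, hw.mulVec_eq_zero_of_rank_le (hY.trans ?_), sub_zero]
          simpa [F] using hi
      _ ≤ _ := Finset.sum_le_sum_of_subset_of_nonneg (Finset.subset_univ _)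
          fun _ _ _ => dotProduct_self_nonneg' _
  -- A Ky Fan bound: `s` orthonormal vectors capture no more of `‖Z‖²` than the `s` largest squared
  -- singular values of `X`. For `s = 0` both sums are empty.
  have h4 : ∑ k ∈ F, (Z *ᵥ w k) ⬝ᵥ (Z *ᵥ w k) ≤ ∑ j ∈ F, sval X (j + 1) ^ 2 := by
    rcases Nat.eq_zero_or_pos s with hs | hs
    · have : F = ∅ := by simp [F, hs]
      simp [this]
    -- `E` sees only the component of `b` in the kernel of `X`, so its contribution fills in the
    -- zero singular values up to level `t`.
    have hb : ∀ b, (Z *ᵥ b) ⬝ᵥ (Z *ᵥ b) ≤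
        t ^ 2 * (b ⬝ᵥ b) + ∑ j ∈ F, (sval X (j + 1) ^ 2 - t ^ 2) * (v j ⬝ᵥ b) ^ 2 := by
      intro b
      have hx : (X *ᵥ b) ⬝ᵥ (E *ᵥ b) = 0 := by
        rw [mulVec_dotProduct, mulVec_mulVec, hXE, zero_mulVec, dotProduct_zero]
      have hz : (Z *ᵥ b) ⬝ᵥ (Z *ᵥ b) =
          (X *ᵥ b) ⬝ᵥ (X *ᵥ b) + t ^ 2 * ((E *ᵥ b) ⬝ᵥ (E *ᵥ b)) := by
        rw [hZ, add_mulVec, smul_mulVec]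
        simp only [add_dotProduct, dotProduct_add, smul_dotProduct, dotProduct_smul,
          dotProduct_comm (E *ᵥ b) (X *ᵥ b), hx, smul_eq_mul]
        ring
      have hE' := hE (kerPart X v b)
      rw [hv.onb.mulVec_kerPart hEv, one_pow, one_mul, hv.onb.kerPart_dotProduct_self] at hE'
      rw [hz, hv.mulVec_dotProduct_mulVec_self, hv.onb.dotProduct_eq_sum b b, hF,
        Finset.sum_filter]
      refine (add_le_add_right (mul_le_mul_of_nonneg_left hE' (sq_nonneg t)) _).trans ?_
      rw [Finset.mul_sum, Finset.mul_sum, ← Finset.sum_add_distrib, ← Finset.sum_add_distrib]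
      refine Finset.sum_le_sum fun j _ => ?_
      split_ifs with h1 h2 h2
      -- A zero singular value among the first `s` forces `σ_s = 0`.
      · have : t = 0 :=
          le_antisymm ((sval_le_sval X (by omega) h2).trans_eq h1) (sval_nonneg _ _)
        simp [h1, this]
      · simp [h1, pow_two]
      · simp only [mul_zero, add_zero]
        nlinarith
      · have h3 : sval X (j + 1) ≤ t := sval_le_sval X hs (by omega)
        have h4 : sval X (j + 1) ^ 2 ≤ t ^ 2 := pow_le_pow_left₀ (sval_nonneg _ _) h3 2
        nlinarith [mul_le_mul_of_nonneg_right h4 (sq_nonneg (v j ⬝ᵥ b))]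
    calc _ ≤ ∑ k ∈ F, (t ^ 2 * (w k ⬝ᵥ w k) +
            ∑ j ∈ F, (sval X (j + 1) ^ 2 - t ^ 2) * (v j ⬝ᵥ w k) ^ 2) :=
          Finset.sum_le_sum fun k _ => hb (w k)
      _ = ∑ k ∈ F, t ^ 2 +
            ∑ j ∈ F, (sval X (j + 1) ^ 2 - t ^ 2) * ∑ k ∈ F, (v j ⬝ᵥ w k) ^ 2 := by
          have h0 : ∀ k, w k ⬝ᵥ w k = 1 := fun k => by rw [hw.onb, if_pos rfl]
          simp only [Finset.sum_add_distrib, Finset.mul_sum, h0, mul_one]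
          rw [Finset.sum_comm]
      _ ≤ ∑ k ∈ F, t ^ 2 + ∑ j ∈ F, (sval X (j + 1) ^ 2 - t ^ 2) * 1 := by
          refine add_le_add_right (Finset.sum_le_sum fun j hj => ?_) _
          have hjs : (j : ℕ) < s := by simpa [F] using hj
          have h0 : t ^ 2 ≤ sval X (j + 1) ^ 2 :=
            pow_le_pow_left₀ (sval_nonneg _ _) (sval_le_sval X (by omega) hjs) 2
          refine mul_le_mul_of_nonneg_left ?_ (sub_nonneg.mpr h0)
          calc ∑ k ∈ F, (v j ⬝ᵥ w k) ^ 2 ≤ ∑ k, (v j ⬝ᵥ w k) ^ 2 :=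
                Finset.sum_le_sum_of_subset_of_nonneg (Finset.subset_univ _)
                  fun _ _ _ => sq_nonneg _
            _ = v j ⬝ᵥ v j := by
                rw [hw.onb.dotProduct_eq_sum (v j) (v j)]
                exact Finset.sum_congr rfl fun k _ => by rw [dotProduct_comm, pow_two]
            _ = 1 := by rw [hv.onb, if_pos rfl]
      _ = _ := by rw [← Finset.sum_add_distrib]; exact Finset.sum_congr rfl fun j _ => by ring
  linarith

/-- The truncated singular value decomposition; minimality is `norm_sub_sq_ge` with `E = 0`. -/
theorem IsRightSingularBasis.exists_isRankProj {X : Matrix (Fin p) (Fin q) ℝ}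
    {v : Fin q → Fin q → ℝ} (hv : IsRightSingularBasis X v) (s : ℕ) :
    ∃ P, IsRankProj s X P ∧ ‖X - P‖ ^ 2 =
      ‖X‖ ^ 2 - ∑ j ∈ (Finset.univ.filter fun j : Fin q => (j : ℕ) < s), sval X (j + 1) ^ 2 := by
  set F : Finset (Fin q) := (Finset.univ.filter fun j : Fin q => (j : ℕ) < s) with hF
  set P : Matrix (Fin p) (Fin q) ℝ := ∑ j ∈ F, vecMulVec (X *ᵥ v j) (v j) with hP
  have hPv : ∀ i, P *ᵥ v i = if (i : ℕ) < s then X *ᵥ v i else 0 := by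
    intro i
    rw [hP, hF, Matrix.sum_mulVec, Finset.sum_filter, Finset.sum_eq_single i]
    · split_ifs
      · rw [vecMulVec_mulVec, hv.onb, if_pos rfl]; simp
      · rfl
    · intro j _ hj
      split_ifs
      · rw [vecMulVec_mulVec, hv.onb, if_neg hj]; simp
      · rfl
    · simp
  have hnorm : ‖X - P‖ ^ 2 = ‖X‖ ^ 2 - ∑ j ∈ F, sval X (j + 1) ^ 2 := by
    rw [hv.onb.norm_sq_eq_sum, hv.norm_sq_eq, hF, Finset.sum_filter,
      ← Finset.sum_sub_distrib]
    refine Finset.sum_congr rfl fun j _ => ?_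
    rw [sub_mulVec, hPv]
    split_ifs
    · simp
    · rw [sub_zero, hv.mulVec_dotProduct_mulVec, if_pos rfl, sub_zero]
  have hrank : P.rank ≤ s := by
    refine le_trans ?_ (card_filter_val_lt_le (q := q) s)
    have h2 : P = (Matrix.of fun i (j : F) => (X *ᵥ v j) i) * Matrix.of fun (j : F) k => v j k := by
      ext i k
      rw [hP, Matrix.sum_apply, Matrix.mul_apply, ← Finset.sum_coe_sort]
      rfl
    rw [h2]
    refine (rank_mul_le_right _ _).trans ((rank_le_card_height _).trans_eq ?_)
    rw [Fintype.card_coe]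
  refine ⟨P, ⟨hrank, fun Q hQ => ?_⟩, hnorm⟩
  have h0 := hv.norm_sub_sq_ge (E := 0) (fun b => by simp [dotProduct_self_nonneg'])
    (fun j _ => zero_mulVec _) (Matrix.mul_zero _) hQ
  have h1 : frobInner (0 : Matrix (Fin p) (Fin q) ℝ) Q = 0 := by simp [frobInner]
  rw [h1, mul_zero, add_zero, ← hnorm] at h0
  exact le_of_sq_le_sq h0 (norm_nonneg _)

end LinearAlgebra

section Stationarity

variable {p q r : ℕ}

/-! ### Stationary points of a factorized loss, in one matrix variable -/

/-- Uniqueness of the positive square root, on one vector: `z = M w - c w` satisfies `M z = -c z`,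
which a positive semidefinite `M` allows only for `z = 0` when `c > 0`. For `c = 0`, `z = M w` and
`z ⬝ᵥ z = w ⬝ᵥ M z = 0`. -/
theorem mulVec_eq_smul_of_sq {k : ℕ} {M : Matrix (Fin k) (Fin k) ℝ} (hs : Mᵀ = M)
    (hM : ∀ z, 0 ≤ z ⬝ᵥ (M *ᵥ z)) {c : ℝ} (hc : 0 ≤ c) {w : Fin k → ℝ}
    (hw : M *ᵥ (M *ᵥ w) = c ^ 2 • w) : M *ᵥ w = c • w := by
  set z := M *ᵥ w - c • w with hz
  have h1 : M *ᵥ z = -(c • z) := by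
    rw [hz, mulVec_sub, mulVec_smul, hw, smul_sub, smul_smul, pow_two]
    abel
  suffices z ⬝ᵥ z = 0 from sub_eq_zero.mp (dotProduct_self_eq_zero.mp this)
  rcases hc.eq_or_lt with h0 | h0
  · rw [← h0, zero_smul, neg_zero] at h1
    have h2 : z = M *ᵥ w := by rw [hz, ← h0, zero_smul, sub_zero]
    calc z ⬝ᵥ z = z ⬝ᵥ (M *ᵥ w) := congrArg (z ⬝ᵥ ·) h2
      _ = 0 := by rw [dotProduct_comm, mulVec_dotProduct, hs, h1, dotProduct_zero]
  · have h2 := hM z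
    rw [h1, dotProduct_neg, dotProduct_smul, smul_eq_mul] at h2
    have h3 := dotProduct_self_nonneg' z
    nlinarith

variable {A : Matrix (Fin p) (Fin r) ℝ} {B : Matrix (Fin q) (Fin r) ℝ}
  {G X : Matrix (Fin p) (Fin q) ℝ} {lam : ℝ}

/-- Both sides are `-Aᵀ G B`, computed with the two stationarity equations. The factor `lam` stays
because nothing is balanced when `lam = 0`. -/
theorem smul_gram_eq (hA : G * B = -(lam • A)) (hB : Gᵀ * A = -(lam • B)) :
    lam • (Aᵀ * A) = lam • (Bᵀ * B) := by
  have h1 : Aᵀ * (G * B) = -(lam • (Aᵀ * A)) := by rw [hA]; simp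
  have h2 : (Gᵀ * A)ᵀ * B = -(lam • (Bᵀ * B)) := by rw [hB]; simp
  rw [transpose_mul, transpose_transpose, Matrix.mul_assoc, h1] at h2
  exact neg_injective h2

/-- Balancedness gives `(lam B Bᵀ)² = lam² Xᵀ X`, so `lam B Bᵀ` is the positive square root of the
right-hand side and shares the right singular vectors of `X`. -/
theorem smul_mul_transpose_mulVec (hlam : 0 ≤ lam) (hA : G * B = -(lam • A))
    (hB : Gᵀ * A = -(lam • B)) (hX : X = A * Bᵀ) {v : Fin q → Fin q → ℝ}
    (hv : IsRightSingularBasis X v) (j : Fin q) :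
    (lam • (B * Bᵀ)) *ᵥ v j = (lam * sval X (j + 1)) • v j := by
  refine mulVec_eq_smul_of_sq (by simp) (fun z => ?_) (mul_nonneg hlam (sval_nonneg _ _)) ?_
  · rw [smul_mulVec, ← mulVec_mulVec, dotProduct_smul, dotProduct_comm, mulVec_dotProduct,
      smul_eq_mul]
    exact mul_nonneg hlam (dotProduct_self_nonneg' _)
  · have : (lam • (B * Bᵀ)) * (lam • (B * Bᵀ)) = lam ^ 2 • (Xᵀ * X) := by
      calc (lam • (B * Bᵀ)) * (lam • (B * Bᵀ)) = lam • (B * (lam • (Bᵀ * B)) * Bᵀ) := by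
            simp [Matrix.mul_assoc]
        _ = lam • (B * (lam • (Aᵀ * A)) * Bᵀ) := by rw [smul_gram_eq hA hB]
        _ = _ := by rw [hX]; simp [Matrix.mul_assoc, smul_smul, pow_two]
    rw [mulVec_mulVec, this, smul_mulVec, ← mulVec_mulVec, hv.eigen, smul_smul, mul_pow]

theorem grad_transpose_mulVec (hlam : 0 ≤ lam) (hA : G * B = -(lam • A))
    (hB : Gᵀ * A = -(lam • B)) (hX : X = A * Bᵀ) {v : Fin q → Fin q → ℝ}
    (hv : IsRightSingularBasis X v) (j : Fin q) :
    Gᵀ *ᵥ (X *ᵥ v j) = -((lam * sval X (j + 1)) • v j) := by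
  rw [← smul_mul_transpose_mulVec hlam hA hB hX hv j, mulVec_mulVec, hX, ← Matrix.mul_assoc, hB]
  simp [neg_mulVec]

theorem grad_mulVec (hlam : 0 ≤ lam) (hA : G * B = -(lam • A))
    (hB : Gᵀ * A = -(lam • B)) (hX : X = A * Bᵀ) {v : Fin q → Fin q → ℝ}
    (hv : IsRightSingularBasis X v) {j : Fin q} (hj : sval X (j + 1) ≠ 0) :
    G *ᵥ v j = -((lam * (sval X (j + 1))⁻¹) • (X *ᵥ v j)) := by
  set σ := sval X (j + 1)
  have h1 : (G * Xᵀ * X) = -(X * (lam • (B * Bᵀ))) := by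
    calc G * Xᵀ * X = (G * B) * (Aᵀ * A * Bᵀ) := by
          rw [hX]; simp [Matrix.mul_assoc]
      _ = -(A * (lam • (Aᵀ * A)) * Bᵀ) := by rw [hA]; simp [Matrix.mul_assoc]
      _ = _ := by rw [smul_gram_eq hA hB, hX]; simp [Matrix.mul_assoc]
  have h2 := congrArg (· *ᵥ v j) h1
  simp only [← mulVec_mulVec, neg_mulVec, hv.eigen,
    smul_mul_transpose_mulVec hlam hA hB hX hv j, mulVec_smul] at h2
  have h3 : G *ᵥ v j = (σ ^ 2)⁻¹ • (σ ^ 2 • (G *ᵥ v j)) := by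
    rw [smul_smul, inv_mul_cancel₀ (pow_ne_zero 2 hj), one_smul]
  rw [h3, h2, smul_neg, smul_smul]
  congr 2
  change (σ ^ 2)⁻¹ * (lam * σ) = lam * σ⁻¹
  field_simp

theorem frobInner_grad (hlam : 0 ≤ lam) (hA : G * B = -(lam • A))
    (hB : Gᵀ * A = -(lam • B)) (hX : X = A * Bᵀ) : frobInner G X = -(lam * nuclearNorm X) := by
  obtain ⟨v, hv⟩ := exists_isRightSingularBasis X
  rw [hv.onb.frobInner_eq_sum, nuclearNorm_eq, Finset.mul_sum, ← Finset.sum_neg_distrib]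
  refine Finset.sum_congr rfl fun j _ => ?_
  rw [mulVec_dotProduct, grad_transpose_mulVec hlam hA hB hX hv, dotProduct_neg, dotProduct_smul,
    hv.onb, if_pos rfl, smul_eq_mul, mul_one]

/-! ### Rank-deficient stationary points -/

theorem exists_mulVec_eq_zero_of_rank_lt (A : Matrix (Fin p) (Fin r) ℝ)
    (B : Matrix (Fin q) (Fin r) ℝ) (h : (A * Bᵀ).rank < r) :
    ∃ y, y ≠ 0 ∧ (A *ᵥ y = 0 ∨ B *ᵥ y = 0) := by
  by_contra! hcon
  have hA : Function.Injective A.mulVecLin := (injective_iff_map_eq_zero _).mpr fun y hy => by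
    by_contra h0; exact (hcon y h0).1 hy
  have hB : Function.Injective B.mulVecLin := (injective_iff_map_eq_zero _).mpr fun y hy => by
    by_contra h0; exact (hcon y h0).2 hy
  have h1 : (A * Bᵀ).rank = B.rank := by
    rw [← Matrix.rank_transpose B, Matrix.rank, Matrix.mulVecLin_mul, LinearMap.range_comp,
      ← (Submodule.equivMapOfInjective _ hA _).finrank_eq]
    rfl
  have h2 : B.rank = r := by
    rw [Matrix.rank, LinearMap.finrank_range_of_inj hB]
    simp
  omega

/-- The optimal test vector is `a = -c⁻¹ G b`, replaced by `-G b` when `c = 0`. -/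
theorem opLe_of_forall_bilinear {c : ℝ} (hc : 0 ≤ c)
    (h : ∀ a b, 0 ≤ 2 * (a ⬝ᵥ (G *ᵥ b)) + c * (a ⬝ᵥ a + b ⬝ᵥ b)) : OpLe G c := by
  intro b
  rcases hc.eq_or_lt with h0 | h0
  · have := h (-(G *ᵥ b)) b
    rw [← h0] at this ⊢
    rw [neg_dotProduct] at this
    nlinarith
  · have := h (-(c⁻¹ • (G *ᵥ b))) b
    simp only [neg_dotProduct, dotProduct_neg, smul_dotProduct, dotProduct_smul,
      smul_eq_mul] at this
    set S := (G *ᵥ b) ⬝ᵥ (G *ᵥ b)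
    have h2 : c * (2 * -(c⁻¹ * S) + c * (c⁻¹ * (c⁻¹ * S) + b ⬝ᵥ b)) = c ^ 2 * (b ⬝ᵥ b) - S := by
      field_simp
      ring
    have h3 := mul_nonneg hc this
    linarith

theorem nonneg_of_forall_add_sq_mul {K C : ℝ} (h : ∀ t : ℝ, 0 < t → 0 ≤ K + t ^ 2 * C) :
    0 ≤ K := by
  have h1 : Tendsto (fun t : ℝ => K + t ^ 2 * C) (𝓝[>] 0) (𝓝 K) := by
    have : Continuous fun t : ℝ => K + t ^ 2 * C := by fun_prop
    simpa using (this.tendsto 0).mono_left nhdsWithin_le_nhds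
  refine ge_of_tendsto h1 ?_
  filter_upwards [self_mem_nhdsWithin] with t ht using h t ht

theorem vecMulVec_zero_right (a : Fin p → ℝ) : vecMulVec a (0 : Fin q → ℝ) = 0 := by
  ext i j
  simp [vecMulVec_apply]

theorem norm_vecMulVec_sq (a : Fin p → ℝ) (b : Fin q → ℝ) :
    ‖vecMulVec a b‖ ^ 2 = (a ⬝ᵥ a) * (b ⬝ᵥ b) := by
  rw [norm_sq_eq_frobInner, frobInner_vecMulVec, vecMulVec_mulVec]
  simp [mul_comm]

/-- At a second-order stationary point whose product has deficient rank, the gradient has operator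
norm at most `lam`. -/
theorem grad_bilinear_of_rank_lt (hlam : 0 ≤ lam) (hA : G * B = -(lam • A))
    (hB : Gᵀ * A = -(lam • B)) {h : Matrix (Fin p) (Fin q) ℝ → ℝ}
    (hh : ∀ (t : ℝ) H, h (t • H) = t ^ 2 * h H)
    (hso : ∀ (dA : Matrix (Fin p) (Fin r) ℝ) (dB : Matrix (Fin q) (Fin r) ℝ),
      0 ≤ 2 * frobInner G (dA * dBᵀ) + h (dA * Bᵀ + A * dBᵀ) + lam * (‖dA‖ ^ 2 + ‖dB‖ ^ 2))
    (hrank : (A * Bᵀ).rank < r) (a : Fin p → ℝ) (b : Fin q → ℝ) :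
    0 ≤ 2 * (a ⬝ᵥ (G *ᵥ b)) + lam * (a ⬝ᵥ a + b ⬝ᵥ b) := by
  obtain ⟨y, hy0, hy⟩ := exists_mulVec_eq_zero_of_rank_lt A B hrank
  have hyy : 0 < y ⬝ᵥ y := (dotProduct_self_nonneg' y).lt_of_ne' fun h0 =>
    hy0 (dotProduct_self_eq_zero.mp h0)
  -- The perturbations `s a yᵀ` and `t b yᵀ` have product `s t (y ⬝ᵥ y) a bᵀ`, while first-order
  -- changes of `A Bᵀ` enter only through `A y` and `B y`.
  have key : ∀ s t : ℝ, 0 ≤ 2 * (s * t * (y ⬝ᵥ y) * (a ⬝ᵥ (G *ᵥ b))) +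
      h (s • vecMulVec a (B *ᵥ y) + t • vecMulVec (A *ᵥ y) b) +
      lam * (s ^ 2 * ((a ⬝ᵥ a) * (y ⬝ᵥ y)) + t ^ 2 * ((b ⬝ᵥ b) * (y ⬝ᵥ y))) := by
    intro s t
    have h1 := hso (s • vecMulVec a y) (t • vecMulVec b y)
    have e1 : (s • vecMulVec a y) * (t • vecMulVec b y)ᵀ =
        (s * t * (y ⬝ᵥ y)) • vecMulVec a b := by
      rw [transpose_smul, transpose_vecMulVec, Matrix.smul_mul, Matrix.mul_smul,
        vecMulVec_mul_vecMulVec, vecMulVec_smul, smul_smul, smul_smul]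
    have e2 : (s • vecMulVec a y) * Bᵀ = s • vecMulVec a (B *ᵥ y) := by
      rw [Matrix.smul_mul, vecMulVec_mul, vecMul_transpose]
    have e3 : A * (t • vecMulVec b y)ᵀ = t • vecMulVec (A *ᵥ y) b := by
      rw [transpose_smul, transpose_vecMulVec, Matrix.mul_smul, mul_vecMulVec]
    rwa [e1, e2, e3, frobInner_smul_right, frobInner_vecMulVec, norm_smul, norm_smul, mul_pow,
      mul_pow, norm_vecMulVec_sq, norm_vecMulVec_sq, Real.norm_eq_abs, Real.norm_eq_abs, sq_abs,
      sq_abs] at h1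
  have hz : h 0 = 0 := by simpa using hh 0 0
  suffices 0 ≤ (y ⬝ᵥ y) * (2 * (a ⬝ᵥ (G *ᵥ b)) + lam * (a ⬝ᵥ a + b ⬝ᵥ b)) from
    nonneg_of_mul_nonneg_right this hyy
  rcases hlam.eq_or_lt with h0 | h0
  -- Without weight decay perhaps only one of `A y`, `B y` vanishes. The scalings `t` and `t⁻¹` keep
  -- the product fixed and shrink the curvature term by `t²`.
  · refine nonneg_of_forall_add_sq_mul
      (C := h (vecMulVec a (B *ᵥ y) + vecMulVec (A *ᵥ y) b)) fun t ht => ?_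
    rw [← h0] at key ⊢
    rcases hy with hy | hy
    · have h1 := key t t⁻¹
      simp only [hy, zero_vecMulVec, smul_zero, add_zero, hh, mul_inv_cancel₀ ht.ne', zero_mul,
        one_mul] at h1 ⊢
      linarith
    · have h1 := key t⁻¹ t
      simp only [hy, vecMulVec_zero_right, smul_zero, zero_add, hh, inv_mul_cancel₀ ht.ne', zero_mul,
        one_mul] at h1 ⊢
      linarith
  -- For `lam > 0` balancedness makes `A` and `B` vanish on `y` together, so the curvature term is
  -- `h 0 = 0`.
  · have hgram := congrArg (fun M => y ⬝ᵥ (M *ᵥ y)) (smul_gram_eq hA hB)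
    simp only [smul_mulVec, ← mulVec_mulVec, dotProduct_smul, ← mulVec_dotProduct, smul_eq_mul]
      at hgram
    have hg := mul_left_cancel₀ h0.ne' hgram
    have hAB : A *ᵥ y = 0 ∧ B *ᵥ y = 0 := by
      rcases hy with hy | hy <;> rw [hy] at hg
      · exact ⟨hy, dotProduct_self_eq_zero.mp (by simpa using hg.symm)⟩
      · exact ⟨dotProduct_self_eq_zero.mp (by simpa using hg), hy⟩
    have h1 := key 1 1
    simp only [hAB.1, hAB.2, zero_vecMulVec, vecMulVec_zero_right, smul_zero, add_zero, hz] at h1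
    linarith

/-- `-G` has operator norm at most `lam` and pairs with `X` to `lam` times its nuclear norm, so it
is `lam` times a subgradient there. -/
theorem frobInner_grad_sub_le_of_rank_lt (hlam : 0 ≤ lam) (hA : G * B = -(lam • A))
    (hB : Gᵀ * A = -(lam • B)) (hX : X = A * Bᵀ) {h : Matrix (Fin p) (Fin q) ℝ → ℝ}
    (hh : ∀ (t : ℝ) H, h (t • H) = t ^ 2 * h H)
    (hso : ∀ (dA : Matrix (Fin p) (Fin r) ℝ) (dB : Matrix (Fin q) (Fin r) ℝ),
      0 ≤ 2 * frobInner G (dA * dBᵀ) + h (dA * Bᵀ + A * dBᵀ) + lam * (‖dA‖ ^ 2 + ‖dB‖ ^ 2))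
    (hrank : X.rank < r) (Y : Matrix (Fin p) (Fin q) ℝ) :
    frobInner G (X - Y) ≤ lam * (nuclearNorm Y - nuclearNorm X) := by
  have hG : OpLe G lam := opLe_of_forall_bilinear hlam
    (grad_bilinear_of_rank_lt hlam hA hB hh hso (hX ▸ hrank))
  have hG' : OpLe (-G) lam := fun b => by simpa [neg_mulVec] using hG b
  have h1 := hG'.frobInner_le_nuclearNorm hlam Y
  rw [frobInner_neg_left] at h1
  rw [frobInner_sub_right, frobInner_grad hlam hA hB hX]
  linarith

/-! ### Full-rank stationary points -/

theorem eq_zero_of_rank_eq_zero (h : X.rank = 0) : X = 0 := by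
  obtain ⟨v, hv⟩ := exists_isRightSingularBasis X
  have h1 := hv.onb.norm_sq_eq_sum X
  rw [Finset.sum_eq_zero fun j _ => by
    rw [hv.mulVec_eq_zero_of_rank_le (h.le.trans (Nat.zero_le _)), dotProduct_zero]] at h1
  exact norm_eq_zero.mp (pow_eq_zero_iff two_ne_zero |>.mp h1)

theorem rank_vecMulVec_eq_one {a : Fin p → ℝ} {b : Fin q → ℝ} (ha : a ⬝ᵥ a = 1)
    (hb : b ⬝ᵥ b = 1) : (vecMulVec a b).rank = 1 := by
  refine le_antisymm (rank_vecMulVec_le a b) (Nat.one_le_iff_ne_zero.mpr fun h0 => ?_)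
  have h1 := norm_vecMulVec_sq a b
  rw [ha, hb, eq_zero_of_rank_eq_zero h0] at h1
  norm_num at h1

/-- At a second-order stationary point, the gradient is bounded on vectors orthogonal to a pair of
singular vectors with positive singular value `σ`. -/
theorem neg_grad_bilinear_le (hlam : 0 ≤ lam) (hA : G * B = -(lam • A))
    (hB : Gᵀ * A = -(lam • B)) (hX : X = A * Bᵀ) {h : Matrix (Fin p) (Fin q) ℝ → ℝ} {β : ℝ}
    (hso : ∀ (dA : Matrix (Fin p) (Fin r) ℝ) (dB : Matrix (Fin q) (Fin r) ℝ),
      0 ≤ 2 * frobInner G (dA * dBᵀ) + h (dA * Bᵀ + A * dBᵀ) + lam * (‖dA‖ ^ 2 + ‖dB‖ ^ 2))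
    (hβ : ∀ (U : Matrix (Fin p) (Fin p) ℝ) (V : Matrix (Fin q) (Fin q) ℝ),
      U.rank = 1 → ‖U‖ = 1 → V.rank = 1 → ‖V‖ = 1 →
        h (U * X + X * V) ≤ β * ‖U * X + X * V‖ ^ 2)
    {v : Fin q → Fin q → ℝ} (hv : IsRightSingularBasis X v) {j : Fin q}
    (hj : 0 < sval X (j + 1)) {a : Fin p → ℝ} {b : Fin q → ℝ} (ha : a ⬝ᵥ (X *ᵥ v j) = 0)
    (hb : b ⬝ᵥ v j = 0) :
    -(a ⬝ᵥ (G *ᵥ b)) ≤ (lam + β * sval X (j + 1)) * (√(a ⬝ᵥ a) * √(b ⬝ᵥ b)) := by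
  set σ := sval X (j + 1) with hσ
  have hunit : ∀ (a : Fin p → ℝ) (b : Fin q → ℝ), a ⬝ᵥ a = 1 → b ⬝ᵥ b = 1 →
      a ⬝ᵥ (X *ᵥ v j) = 0 → b ⬝ᵥ v j = 0 → -(a ⬝ᵥ (G *ᵥ b)) ≤ lam + β * σ := by
    intro a b haa hbb ha hb
    set u := σ⁻¹ • (X *ᵥ v j) with hu
    have hvv : v j ⬝ᵥ v j = 1 := by rw [hv.onb, if_pos rfl]
    have hXv : X *ᵥ v j = σ • u := by
      rw [hu, smul_smul, mul_inv_cancel₀ hj.ne', one_smul]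
    have hXu : Xᵀ *ᵥ u = σ • v j := by
      rw [hu, mulVec_smul, hv.eigen, smul_smul, ← hσ, pow_two, ← mul_assoc,
        inv_mul_cancel₀ hj.ne', one_mul]
    have huu : u ⬝ᵥ u = 1 := by
      have h1 := hv.mulVec_dotProduct_mulVec j j
      rw [if_pos rfl] at h1
      rw [hu, smul_dotProduct, dotProduct_smul, h1, ← hσ, smul_eq_mul, smul_eq_mul]
      field_simp
    have hau : a ⬝ᵥ u = 0 := by rw [hu, dotProduct_smul, ha, smul_zero]
    have hGv : G *ᵥ v j = -(lam • u) := by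
      rw [grad_mulVec hlam hA hB hX hv hj.ne', hu, smul_smul]
    have hBA : B *ᵥ (Aᵀ *ᵥ u) = σ • v j := by
      rw [mulVec_mulVec, ← hXu, hX, transpose_mul, transpose_transpose]
    have hAB : A *ᵥ (Bᵀ *ᵥ v j) = σ • u := by rw [mulVec_mulVec, ← hX, hXv]
    -- The test perturbation is `dA = a (Aᵀ u)ᵀ`, `dB = b (Bᵀ v)ᵀ`. Its first-order effect `σ (a vᵀ
    -- + u bᵀ)` has the form `U X + X V` with rank-one `U = a uᵀ`, `V = v bᵀ`, as restricted
    -- smoothness requires; orthogonality makes its squared norm `2 σ²`.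
    have e1 : vecMulVec a (Aᵀ *ᵥ u) * (vecMulVec b (Bᵀ *ᵥ v j))ᵀ = σ • vecMulVec a b := by
      have : (Aᵀ *ᵥ u) ⬝ᵥ (Bᵀ *ᵥ v j) = σ := by
        rw [← mulVec_dotProduct, hBA, smul_dotProduct, hvv, smul_eq_mul, mul_one]
      rw [transpose_vecMulVec, vecMulVec_mul_vecMulVec, this, vecMulVec_smul]
    have e2 : vecMulVec a (Aᵀ *ᵥ u) * Bᵀ + A * (vecMulVec b (Bᵀ *ᵥ v j))ᵀ =
        vecMulVec a u * X + X * vecMulVec (v j) b := by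
      rw [transpose_vecMulVec, vecMulVec_mul, vecMul_transpose, hBA, mul_vecMulVec, hAB,
        vecMulVec_mul, ← mulVec_transpose, hXu, mul_vecMulVec, hXv]
    have e3 : ‖vecMulVec a u * X + X * vecMulVec (v j) b‖ ^ 2 = 2 * σ ^ 2 := by
      rw [vecMulVec_mul, ← mulVec_transpose, hXu, mul_vecMulVec, hXv, norm_sq_eq_frobInner,
        frobInner_add_left, frobInner_add_right, frobInner_add_right,
        frobInner_comm (vecMulVec (σ • u) b)]
      simp only [← norm_sq_eq_frobInner, norm_vecMulVec_sq]
      rw [frobInner_vecMulVec, vecMulVec_mulVec]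
      simp only [smul_dotProduct, dotProduct_smul, dotProduct_comm u a, hau, huu, hvv, haa, hbb,
        dotProduct_comm (v j) b, hb, smul_eq_mul]
      simp
      ring
    have e4 : lam * ((Aᵀ *ᵥ u) ⬝ᵥ (Aᵀ *ᵥ u)) = lam * σ := by
      have h1 : lam • (A * Aᵀ) = -(G * Xᵀ) := by
        rw [hX, transpose_mul, transpose_transpose, ← Matrix.mul_assoc, hA]
        simp
      calc lam * ((Aᵀ *ᵥ u) ⬝ᵥ (Aᵀ *ᵥ u)) = u ⬝ᵥ ((lam • (A * Aᵀ)) *ᵥ u) := by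
            rw [smul_mulVec, dotProduct_smul, ← mulVec_mulVec, smul_eq_mul, mulVec_dotProduct,
              transpose_transpose]
        _ = lam * σ := by
            rw [h1, neg_mulVec, ← mulVec_mulVec, hXu, mulVec_smul, hGv]
            simp [huu, mul_comm]
    have e5 : lam * ((Bᵀ *ᵥ v j) ⬝ᵥ (Bᵀ *ᵥ v j)) = lam * σ := by
      calc lam * ((Bᵀ *ᵥ v j) ⬝ᵥ (Bᵀ *ᵥ v j)) = v j ⬝ᵥ ((lam • (B * Bᵀ)) *ᵥ v j) := by
            rw [smul_mulVec, dotProduct_smul, ← mulVec_mulVec, smul_eq_mul, mulVec_dotProduct]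
            simp
        _ = lam * σ := by
            rw [smul_mul_transpose_mulVec hlam hA hB hX hv j, dotProduct_smul, hvv, ← hσ,
              smul_eq_mul, mul_one]
    have h1 := hso (vecMulVec a (Aᵀ *ᵥ u)) (vecMulVec b (Bᵀ *ᵥ v j))
    have nrm : ∀ {k l : ℕ} (x : Fin k → ℝ) (y : Fin l → ℝ), x ⬝ᵥ x = 1 → y ⬝ᵥ y = 1 →
        ‖vecMulVec x y‖ = 1 := fun x y hx hy => by
      have := norm_vecMulVec_sq x y
      rw [hx, hy, mul_one] at this
      exact (pow_eq_one_iff_of_nonneg (norm_nonneg _) two_ne_zero).mp this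
    have h2 := hβ (vecMulVec a u) (vecMulVec (v j) b) (rank_vecMulVec_eq_one haa huu)
      (nrm _ _ haa huu) (rank_vecMulVec_eq_one hvv hbb) (nrm _ _ hvv hbb)
    rw [e1, e2, frobInner_smul_right, frobInner_vecMulVec, norm_vecMulVec_sq, norm_vecMulVec_sq,
      haa, hbb, one_mul, one_mul, mul_add, e4, e5] at h1
    rw [e3] at h2
    have h3 : 0 ≤ (2 * σ) * (a ⬝ᵥ (G *ᵥ b) + (lam + β * σ)) := by linarith
    have := nonneg_of_mul_nonneg_right h3 (by positivity)
    linarith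
  rcases (dotProduct_self_nonneg' a).eq_or_lt with h0 | ha0
  · rw [dotProduct_self_eq_zero.mp h0.symm]; simp
  rcases (dotProduct_self_nonneg' b).eq_or_lt with h0 | hb0
  · rw [dotProduct_self_eq_zero.mp h0.symm]; simp
  have hsa := Real.sqrt_pos.mpr ha0
  have hsb := Real.sqrt_pos.mpr hb0
  have hn : ∀ {k : ℕ} (x : Fin k → ℝ), 0 < x ⬝ᵥ x →
      ((√(x ⬝ᵥ x))⁻¹ • x) ⬝ᵥ ((√(x ⬝ᵥ x))⁻¹ • x) = 1 := fun x hx => by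
    have h1 := Real.mul_self_sqrt hx.le
    have h2 := (Real.sqrt_pos.mpr hx).ne'
    rw [smul_dotProduct, dotProduct_smul, smul_eq_mul, smul_eq_mul, ← mul_assoc, ← mul_inv, h1,
      inv_mul_cancel₀ hx.ne']
  have h1 := hunit ((√(a ⬝ᵥ a))⁻¹ • a) ((√(b ⬝ᵥ b))⁻¹ • b) (hn a ha0) (hn b hb0)
    (by rw [smul_dotProduct, ha, smul_zero]) (by rw [smul_dotProduct, hb, smul_zero])
  rw [smul_dotProduct, mulVec_smul, dotProduct_smul, smul_eq_mul, smul_eq_mul] at h1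
  have h2 := mul_le_mul_of_nonneg_right h1 (mul_pos hsa hsb).le
  refine le_trans (le_of_eq ?_) h2
  field_simp

/-- Decomposition of the gradient at a second-order stationary point of full rank: up to a
contraction `E` acting orthogonally to `X`, it is the negative of a subgradient of the nuclear
norm. -/
theorem exists_contraction_of_rank_eq (hlam : 0 ≤ lam) (hA : G * B = -(lam • A))
    (hB : Gᵀ * A = -(lam • B)) (hX : X = A * Bᵀ) {h : Matrix (Fin p) (Fin q) ℝ → ℝ} {β : ℝ}
    (hso : ∀ (dA : Matrix (Fin p) (Fin r) ℝ) (dB : Matrix (Fin q) (Fin r) ℝ),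
      0 ≤ 2 * frobInner G (dA * dBᵀ) + h (dA * Bᵀ + A * dBᵀ) + lam * (‖dA‖ ^ 2 + ‖dB‖ ^ 2))
    (hβ : ∀ (U : Matrix (Fin p) (Fin p) ℝ) (V : Matrix (Fin q) (Fin q) ℝ),
      U.rank = 1 → ‖U‖ = 1 → V.rank = 1 → ‖V‖ = 1 →
        h (U * X + X * V) ≤ β * ‖U * X + X * V‖ ^ 2)
    {v : Fin q → Fin q → ℝ} (hv : IsRightSingularBasis X v) (hr : 0 < r) (hrank : X.rank = r) :
    ∃ E, OpLe E 1 ∧ (∀ j : Fin q, sval X (j + 1) ≠ 0 → E *ᵥ v j = 0) ∧ Xᵀ * E = 0 ∧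
      ∀ Y, frobInner G (X - Y) ≤
        lam * (nuclearNorm Y - nuclearNorm X) + max β 0 * sval X r * frobInner E Y := by
  obtain ⟨k, rfl⟩ := Nat.exists_eq_add_of_le' hr
  have hkq : k < q := by have := X.rank_le_width; omega
  set j₀ : Fin q := ⟨k, hkq⟩
  have hσ : 0 < sval X (k + 1) := (sval_succ_pos_iff X k).mpr (by omega)
  set σ := sval X (k + 1) with hσdef
  set W := polarFactor X v with hW
  set κ := max β 0 * σ with hκ
  have hκ0 : 0 ≤ κ := mul_nonneg (le_max_right _ _) hσ.le
  set τ := lam + κ with hτ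
  have hτ0 : 0 ≤ τ := add_nonneg hlam hκ0
  -- `N` is what remains of `-G` after the part dictated by first-order stationarity; it vanishes on
  -- the row space of `X` and its range is orthogonal to that of `X`.
  set N := -G - lam • W with hN
  have hNv : ∀ j : Fin q, sval X (j + 1) ≠ 0 → N *ᵥ v j = 0 := by
    intro j hj
    rw [hN, sub_mulVec, neg_mulVec, smul_mulVec, hW, hv.polarFactor_mulVec,
      grad_mulVec hlam hA hB hX hv hj, neg_neg, smul_smul, sub_self]
  have hXN : Xᵀ * N = 0 := by
    have h1 : ∀ i, (Nᵀ * X) *ᵥ v i = 0 := by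
      intro i
      have h2 : ∀ l, v l ⬝ᵥ (Nᵀ *ᵥ (X *ᵥ v i)) = 0 := by
        intro l
        rw [← mulVec_dotProduct]
        rcases eq_or_ne (sval X (l + 1)) 0 with hl | hl
        · rw [hN, sub_mulVec, neg_mulVec, smul_mulVec, hW, hv.polarFactor_mulVec, hl, _root_.inv_zero,
            zero_smul, smul_zero, sub_zero, neg_dotProduct, mulVec_dotProduct,
            grad_transpose_mulVec hlam hA hB hX hv, dotProduct_neg, dotProduct_smul, hv.onb]
          split_ifs with h
          · rw [← h, hl]; simp
          · simp
        · rw [hNv l hl, zero_dotProduct]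
      rw [← mulVec_mulVec, hv.onb.eq_sum (Nᵀ *ᵥ (X *ᵥ v i))]
      exact Finset.sum_eq_zero fun l _ => by rw [h2, zero_smul]
    have h3 : Nᵀ * X = 0 := by
      have := hv.onb.norm_sq_eq_sum (Nᵀ * X)
      simp only [h1, zero_dotProduct, Finset.sum_const_zero] at this
      exact norm_eq_zero.mp (pow_eq_zero_iff two_ne_zero |>.mp this)
    have := congrArg Matrix.transpose h3
    simpa using this
  have hWN : Wᵀ * N = 0 := by
    rw [hW, polarFactor, transpose_mul, Matrix.mul_assoc, hXN, Matrix.mul_zero]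
  -- Testing with `a = N b` and the kernel part `b'` is admissible for the pair of index `j₀`, whose
  -- singular value is `σ_r` (zero-based index `k = r - 1`). It gives `|a|² ≤ τ |a| |b'|`, and a
  -- factor `|a|` cancels.
  have hNop : ∀ b, (N *ᵥ b) ⬝ᵥ (N *ᵥ b) ≤ τ ^ 2 * (kerPart X v b ⬝ᵥ kerPart X v b) := by
    intro b
    set b' := kerPart X v b with hb'
    set a := N *ᵥ b with ha
    have hab : a = N *ᵥ b' := (hv.onb.mulVec_kerPart hNv b).symm
    have h1 : a ⬝ᵥ (X *ᵥ v j₀) = 0 := by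
      rw [dotProduct_comm, mulVec_dotProduct, ha, mulVec_mulVec, hXN, zero_mulVec,
        dotProduct_zero]
    have h2 : b' ⬝ᵥ v j₀ = 0 := by
      rw [dotProduct_comm, hv.onb.dotProduct_kerPart, if_neg hσ.ne']
    have h3 := neg_grad_bilinear_le hlam hA hB hX hso hβ hv hσ h1 h2
    have h4 : a ⬝ᵥ a = -(a ⬝ᵥ (G *ᵥ b')) := by
      have h5 : a ⬝ᵥ (W *ᵥ b') = 0 := by
        rw [dotProduct_comm, mulVec_dotProduct, ha, mulVec_mulVec, hWN, zero_mulVec,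
          dotProduct_zero]
      calc a ⬝ᵥ a = a ⬝ᵥ (N *ᵥ b') := congrArg (a ⬝ᵥ ·) hab
        _ = _ := by
          rw [hN, sub_mulVec, neg_mulVec, smul_mulVec, dotProduct_sub, dotProduct_neg,
            dotProduct_smul, h5, smul_zero, sub_zero]
    have h6 : a ⬝ᵥ a ≤ τ * (√(a ⬝ᵥ a) * √(b' ⬝ᵥ b')) := by
      rw [← h4] at h3
      refine h3.trans (mul_le_mul_of_nonneg_right ?_ (by positivity))
      exact add_le_add_right (mul_le_mul_of_nonneg_right (le_max_left _ _) hσ.le) _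
    set S := √(a ⬝ᵥ a) with hS
    set S' := √(b' ⬝ᵥ b') with hS'
    have e1 : a ⬝ᵥ a = S ^ 2 := (Real.sq_sqrt (dotProduct_self_nonneg' a)).symm
    have e2 : b' ⬝ᵥ b' = S' ^ 2 := (Real.sq_sqrt (dotProduct_self_nonneg' b')).symm
    have hS0 : 0 ≤ S := Real.sqrt_nonneg _
    have hS0' : 0 ≤ S' := Real.sqrt_nonneg _
    rw [e1] at h6 ⊢
    rw [e2, ← mul_pow]
    refine pow_le_pow_left₀ hS0 ?_ 2
    rcases hS0.eq_or_lt with h0 | h0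
    · rw [← h0]; positivity
    · have : S * S ≤ S * (τ * S') := by nlinarith
      exact le_of_mul_le_mul_left this h0
  have hEker : ∀ b, ((τ⁻¹ • N) *ᵥ b) ⬝ᵥ ((τ⁻¹ • N) *ᵥ b) ≤ kerPart X v b ⬝ᵥ kerPart X v b := by
    intro b
    rw [smul_mulVec, smul_dotProduct, dotProduct_smul, smul_eq_mul, smul_eq_mul]
    rcases hτ0.eq_or_lt with h0 | h0
    · rw [← h0, _root_.inv_zero, zero_mul]; exact dotProduct_self_nonneg' _
    · calc τ⁻¹ * (τ⁻¹ * ((N *ᵥ b) ⬝ᵥ (N *ᵥ b)))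
          ≤ τ⁻¹ * (τ⁻¹ * (τ ^ 2 * (kerPart X v b ⬝ᵥ kerPart X v b))) := by
            have := hNop b
            gcongr
        _ = _ := by field_simp
  -- If `τ = 0` then `N = 0` by the norm bound, so the default `0⁻¹ = 0` does no harm.
  have hτE : τ • (τ⁻¹ • N) = N := by
    rcases hτ0.eq_or_lt with h0 | h0
    · have h1 : N = 0 := by
        have h2 := hv.onb.norm_sq_eq_sum N
        have h3 : ∀ b, (N *ᵥ b) ⬝ᵥ (N *ᵥ b) = 0 := fun b =>
          le_antisymm (by simpa [← h0] using hNop b) (dotProduct_self_nonneg' _)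
        simp only [h3, Finset.sum_const_zero] at h2
        exact norm_eq_zero.mp (pow_eq_zero_iff two_ne_zero |>.mp h2)
      rw [h1, smul_zero, smul_zero]
    · rw [smul_smul, mul_inv_cancel₀ h0.ne', one_smul]
  set E := τ⁻¹ • N with hE
  have hXE : Xᵀ * E = 0 := by rw [hE, Matrix.mul_smul, hXN, smul_zero]
  have hE1 : OpLe E 1 := fun b => by
    refine (hEker b).trans ?_
    rw [hv.onb.kerPart_dotProduct_self, hv.onb.dotProduct_eq_sum b b, one_pow, one_mul]
    refine Finset.sum_le_sum fun j _ => ?_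
    split_ifs
    · rw [pow_two]
    · exact mul_self_nonneg _
  -- `W` and `E` have orthogonal ranges and act on complementary singular directions, so their sum
  -- is still a contraction.
  have hWE : OpLe (W + E) 1 := fun b => by
    have hcross : (W *ᵥ b) ⬝ᵥ (E *ᵥ b) = 0 := by
      rw [mulVec_dotProduct, mulVec_mulVec, hE, Matrix.mul_smul, hWN, smul_zero, zero_mulVec,
        dotProduct_zero]
    have h1 := hEker b
    rw [hv.onb.kerPart_dotProduct_self] at h1
    rw [add_mulVec, add_dotProduct, dotProduct_add, dotProduct_add,
      dotProduct_comm (E *ᵥ b) (W *ᵥ b), hcross, add_zero, zero_add,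
      hv.polarFactor_mulVec_dotProduct_self, hv.onb.dotProduct_eq_sum b b, one_pow, one_mul]
    refine (add_le_add_right h1 _).trans (le_of_eq ?_)
    rw [← Finset.sum_add_distrib]
    refine Finset.sum_congr rfl fun j _ => ?_
    split_ifs
    · rw [zero_add, pow_two]
    · rw [add_zero, pow_two]
  refine ⟨E, hE1, fun j hj => ?_, hXE, fun Y => ?_⟩
  · rw [hE, smul_mulVec, hNv j hj, smul_zero]
  · have hG : G = -(lam • (W + E) + κ • E) := by
      have : N = lam • E + κ • E := by rw [← add_smul]; exact hτE.symm
      rw [smul_add, add_assoc, ← this, hN]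
      abel
    have h1 := hWE.frobInner_le_nuclearNorm zero_le_one Y
    have h2 : frobInner E X = 0 := by
      rw [frobInner_comm, frobInner, hXE, Matrix.trace_zero]
    have h3 : frobInner G Y = -(lam * frobInner (W + E) Y + κ * frobInner E Y) := by
      conv_lhs => rw [hG]
      rw [frobInner_neg_left, frobInner_add_left, frobInner_smul_left, frobInner_smul_left]
    rw [frobInner_sub_right, frobInner_grad hlam hA hB hX, h3]
    have h4 := mul_le_mul_of_nonneg_left h1 hlam
    linarith

end Stationarity

section Calculus

/-! ### Derivatives along quadratic curves -/

/-- The first derivatives agree for every `t`, so the identity can be differentiated once more at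
`0`; the acceleration `2 Q` of the curve contributes the gradient term. Perturbing one layer of `(A,
B)` moves `A Bᵀ` along such a curve, and weight decay supplies the polynomial. -/
theorem fderiv_and_iteratedFDeriv_of_quadratic_curve {E F : Type*} [NormedAddCommGroup E]
    [NormedSpace ℝ E] [NormedAddCommGroup F] [NormedSpace ℝ F] {g : E → ℝ} {f : F → ℝ}
    (hg : ContDiff ℝ 2 g) (hf : ContDiff ℝ 2 f) {p u : E} {X P Q : F} {c₀ c₁ c₂ : ℝ}
    (h : ∀ t : ℝ, g (p + t • u) = f (X + t • P + t ^ 2 • Q) + (c₀ + t * c₁ + t ^ 2 * c₂)) :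
    fderiv ℝ g p u = fderiv ℝ f X P + c₁ ∧
      iteratedFDeriv ℝ 2 g p ![u, u] =
        iteratedFDeriv ℝ 2 f X ![P, P] + 2 * fderiv ℝ f X Q + 2 * c₂ := by
  have hline : ∀ t : ℝ, HasDerivAt (fun s : ℝ => p + s • u) u t := fun t => by
    simpa using ((hasDerivAt_id t).smul_const u).const_add p
  have hpow : ∀ t : ℝ, HasDerivAt (fun s : ℝ => s ^ 2) (2 * t) t := fun t => by
    simpa using hasDerivAt_pow 2 t
  have hcurve : ∀ t : ℝ, HasDerivAt (fun s : ℝ => X + s • P + s ^ 2 • Q)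
      (P + (2 * t) • Q) t := fun t => by
    have h1 := (((hasDerivAt_id t).smul_const P).const_add X).add ((hpow t).smul_const Q)
    rw [one_smul] at h1
    exact h1
  have hpoly : ∀ t : ℝ, HasDerivAt (fun s : ℝ => c₀ + s * c₁ + s ^ 2 * c₂)
      (c₁ + 2 * t * c₂) t := fun t => by
    have h1 := (((hasDerivAt_id t).mul_const c₁).const_add c₀).add ((hpow t).mul_const c₂)
    rw [one_mul] at h1
    exact h1
  have hfirst : ∀ t : ℝ, fderiv ℝ g (p + t • u) u =
      fderiv ℝ f (X + t • P + t ^ 2 • Q) (P + (2 * t) • Q) + (c₁ + 2 * t * c₂) := by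
    intro t
    have h1 : HasDerivAt (fun s : ℝ => g (p + s • u)) (fderiv ℝ g (p + t • u) u) t :=
      ((hg.differentiable (by norm_num)) _).hasFDerivAt.comp_hasDerivAt t (hline t)
    have h2 : HasDerivAt (fun s : ℝ => f (X + s • P + s ^ 2 • Q) + (c₀ + s * c₁ + s ^ 2 * c₂))
        (fderiv ℝ f (X + t • P + t ^ 2 • Q) (P + (2 * t) • Q) + (c₁ + 2 * t * c₂)) t :=
      (((hf.differentiable (by norm_num)) _).hasFDerivAt.comp_hasDerivAt t (hcurve t)).add (hpoly t)
    rw [← funext h] at h2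
    exact h1.unique h2
  refine ⟨by simpa using hfirst 0, ?_⟩
  have hg' : Differentiable ℝ (fderiv ℝ g) :=
    (hg.fderiv_right (m := 1) (by norm_num)).differentiable (by norm_num)
  have hf' : Differentiable ℝ (fderiv ℝ f) :=
    (hf.fderiv_right (m := 1) (by norm_num)).differentiable (by norm_num)
  have h1 : HasDerivAt (fun s : ℝ => fderiv ℝ g (p + s • u) u)
      (fderiv ℝ (fderiv ℝ g) (p + (0 : ℝ) • u) u u) 0 := by
    have := (((hg' _).hasFDerivAt.comp_hasDerivAt (0 : ℝ) (hline 0))).clm_apply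
      (hasDerivAt_const (0 : ℝ) u)
    rw [map_zero, add_zero] at this
    exact this
  have h2 : HasDerivAt (fun s : ℝ => fderiv ℝ f (X + s • P + s ^ 2 • Q) (P + (2 * s) • Q) +
      (c₁ + 2 * s * c₂)) (fderiv ℝ (fderiv ℝ f) (X + (0 : ℝ) • P + (0 : ℝ) ^ 2 • Q)
        (P + (2 * (0 : ℝ)) • Q) (P + (2 * (0 : ℝ)) • Q) +
        fderiv ℝ f (X + (0 : ℝ) • P + (0 : ℝ) ^ 2 • Q) ((2 : ℝ) • Q) + 2 * c₂) 0 := by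
    have ha : HasDerivAt (fun s : ℝ => P + (2 * s) • Q) ((2 : ℝ) • Q) 0 := by
      simpa using ((((hasDerivAt_id (0 : ℝ)).const_mul 2).smul_const Q).const_add P)
    have hb : HasDerivAt (fun s : ℝ => c₁ + 2 * s * c₂) (2 * c₂) 0 := by
      simpa using ((((hasDerivAt_id (0 : ℝ)).const_mul 2).mul_const c₂).const_add c₁)
    exact (((hf' _).hasFDerivAt.comp_hasDerivAt (0 : ℝ) (hcurve 0)).clm_apply ha).add hb
  rw [← funext hfirst] at h2
  have h3 := h1.unique h2
  rw [iteratedFDeriv_two_apply, iteratedFDeriv_two_apply]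
  simpa using h3

theorem LinearMap.contDiff_of_finiteDimensional {E F : Type*} [NormedAddCommGroup E]
    [NormedSpace ℝ E] [FiniteDimensional ℝ E] [NormedAddCommGroup F] [NormedSpace ℝ F]
    (T : E →ₗ[ℝ] F) {k : WithTop ℕ∞} : ContDiff ℝ k T :=
  (LinearMap.toContinuousLinearMap T).contDiff

/-! ### The LoRA loss under single-layer perturbations -/

variable {L : ℕ} {m n : Fin L → ℕ} {r : ℕ}

/-- The linear functional `X ↦ X⁽ˡ⁾ i j`. -/
def entryLin (m n : Fin L → ℕ) (l : Fin L) (i : Fin (m l)) (j : Fin (n l)) :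
    MatTuple m n →ₗ[ℝ] ℝ where
  toFun X := X l i j
  map_add' _ _ := rfl
  map_smul' _ _ := rfl

theorem tupleNorm_sq (X : MatTuple m n) : tupleNorm X ^ 2 = ∑ l, ‖X l‖ ^ 2 :=
  Real.sq_sqrt (Finset.sum_nonneg fun _ _ => sq_nonneg _)

theorem norm_le_tupleNorm (X : MatTuple m n) (l : Fin L) : ‖X l‖ ≤ tupleNorm X := by
  refine le_of_sq_le_sq ?_ (Real.sqrt_nonneg _)
  rw [tupleNorm_sq]
  exact Finset.single_le_sum (f := fun l => ‖X l‖ ^ 2) (fun _ _ => sq_nonneg _) (Finset.mem_univ l)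

theorem rank_le_tupleRank (X : MatTuple m n) (l : Fin L) : (X l).rank ≤ tupleRank X :=
  Finset.le_sup (f := fun l => (X l).rank) (Finset.mem_univ l)

theorem contDiff_tupleNorm_sq {k : WithTop ℕ∞} :
    ContDiff ℝ k fun X : MatTuple m n => tupleNorm X ^ 2 := by
  have : (fun X : MatTuple m n => tupleNorm X ^ 2) =
      fun X => ∑ l, ∑ i, ∑ j, entryLin m n l i j X * entryLin m n l i j X := by
    funext X
    rw [tupleNorm_sq]
    exact Finset.sum_congr rfl fun l _ => by rw [norm_sq_eq_frobInner, frobInner_eq_sum]; rfl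
  rw [this]
  refine ContDiff.sum fun l _ => ContDiff.sum fun i _ => ContDiff.sum fun j _ => ?_
  have := LinearMap.contDiff_of_finiteDimensional (entryLin m n l i j) (k := k)
  exact this.mul this

theorem contDiff_lowRankProd {k : WithTop ℕ∞} :
    ContDiff ℝ k fun p : MatTuple m (fun _ => r) × MatTuple n (fun _ => r) =>
      lowRankProd p.1 p.2 := by
  refine contDiff_pi.mpr fun l => ?_
  have : (fun p : MatTuple m (fun _ => r) × MatTuple n (fun _ => r) => lowRankProd p.1 p.2 l) =
      fun p => ∑ i, ∑ j, (∑ s, entryLin m (fun _ => r) l i s p.1 *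
        entryLin n (fun _ => r) l j s p.2) • Matrix.single i j (1 : ℝ) := by
    funext p
    conv_lhs => rw [Matrix.matrix_eq_sum_single (lowRankProd p.1 p.2 l)]
    refine Finset.sum_congr rfl fun i _ => Finset.sum_congr rfl fun j _ => ?_
    rw [Matrix.smul_single, smul_eq_mul, mul_one, lowRankProd, Matrix.mul_apply]
    rfl
  rw [this]
  refine ContDiff.sum fun i _ => ContDiff.sum fun j _ => ?_
  have : ContDiff ℝ k fun p : MatTuple m (fun _ => r) × MatTuple n (fun _ => r) =>
      ∑ s, entryLin m (fun _ => r) l i s p.1 * entryLin n (fun _ => r) l j s p.2 :=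
    ContDiff.sum fun s _ => ((LinearMap.contDiff_of_finiteDimensional _).comp contDiff_fst).mul
      ((LinearMap.contDiff_of_finiteDimensional _).comp contDiff_snd)
  exact this.smul contDiff_const

theorem contDiff_regLoraLoss {f : MatTuple m n → ℝ} (hf : ContDiff ℝ 2 f) (lam : ℝ) :
    ContDiff ℝ 2 (regLoraLoss f lam r) :=
  (hf.comp contDiff_lowRankProd).add (contDiff_const.mul
    ((contDiff_tupleNorm_sq.comp contDiff_fst).add (contDiff_tupleNorm_sq.comp contDiff_snd)))

theorem tupleNorm_add_single_sq (X : MatTuple m n) (l : Fin L)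
    (H : Matrix (Fin (m l)) (Fin (n l)) ℝ) (t : ℝ) :
    tupleNorm (X + t • (Pi.single l H : MatTuple m n)) ^ 2 =
      tupleNorm X ^ 2 + t * (2 * frobInner (X l) H) + t ^ 2 * ‖H‖ ^ 2 := by
  have h1 : tupleNorm (X + t • (Pi.single l H : MatTuple m n)) ^ 2 - tupleNorm X ^ 2 =
      t * (2 * frobInner (X l) H) + t ^ 2 * ‖H‖ ^ 2 := by
    rw [tupleNorm_sq, tupleNorm_sq, ← Finset.sum_sub_distrib, Finset.sum_eq_single l]
    · simp only [Pi.add_apply, Pi.smul_apply, Pi.single_eq_same, norm_sq_eq_frobInner,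
        frobInner_add_left, frobInner_add_right, frobInner_smul_left, frobInner_smul_right,
        frobInner_comm H (X l)]
      ring
    · intro l' _ hl'
      simp [Pi.single_eq_of_ne hl']
    · simp
  linarith

theorem regLoraLoss_line (f : MatTuple m n → ℝ) (lam : ℝ) (A : MatTuple m fun _ => r)
    (B : MatTuple n fun _ => r) (l : Fin L) (dA : Matrix (Fin (m l)) (Fin r) ℝ)
    (dB : Matrix (Fin (n l)) (Fin r) ℝ) (t : ℝ) :
    regLoraLoss f lam r ((A, B) + t • (Pi.single l dA, Pi.single l dB)) =
      f (lowRankProd A B + t • (Pi.single l (dA * (B l)ᵀ + A l * dBᵀ) : MatTuple m n) +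
        t ^ 2 • (Pi.single l (dA * dBᵀ) : MatTuple m n)) +
      (lam / 2 * (tupleNorm A ^ 2 + tupleNorm B ^ 2) +
        t * (lam * (frobInner (A l) dA + frobInner (B l) dB)) +
        t ^ 2 * (lam / 2 * (‖dA‖ ^ 2 + ‖dB‖ ^ 2))) := by
  have h1 : lowRankProd (A + t • (Pi.single l dA : MatTuple m fun _ => r))
      (B + t • (Pi.single l dB : MatTuple n fun _ => r)) =
      lowRankProd A B + t • (Pi.single l (dA * (B l)ᵀ + A l * dBᵀ) : MatTuple m n) +
        t ^ 2 • (Pi.single l (dA * dBᵀ) : MatTuple m n) := by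
    funext l'
    rcases eq_or_ne l' l with rfl | hl'
    · simp only [lowRankProd, Pi.add_apply, Pi.smul_apply, Pi.single_eq_same, transpose_add,
        transpose_smul, Matrix.add_mul, Matrix.mul_add, Matrix.smul_mul, Matrix.mul_smul,
        smul_add, smul_smul, pow_two]
      abel
    · simp [lowRankProd, Pi.single_eq_of_ne hl']
  change f (lowRankProd (A + t • (Pi.single l dA : MatTuple m fun _ => r))
    (B + t • (Pi.single l dB : MatTuple n fun _ => r))) + lam / 2 *
    (tupleNorm (A + t • (Pi.single l dA : MatTuple m fun _ => r)) ^ 2 +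
      tupleNorm (B + t • (Pi.single l dB : MatTuple n fun _ => r)) ^ 2) = _
  rw [h1, tupleNorm_add_single_sq, tupleNorm_add_single_sq]
  ring

theorem fderiv_single (f : MatTuple m n → ℝ) (X : MatTuple m n) (l : Fin L)
    (M : Matrix (Fin (m l)) (Fin (n l)) ℝ) :
    fderiv ℝ f X (Pi.single l M) = frobInner (blockGrad f l X) M := by
  let T : Matrix (Fin (m l)) (Fin (n l)) ℝ →ₗ[ℝ] ℝ :=
    (fderiv ℝ f X).toLinearMap ∘ₗ LinearMap.single ℝ (fun l => Matrix (Fin (m l)) (Fin (n l)) ℝ) l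
  change T M = _
  rw [frobInner_eq_sum]
  conv_lhs => rw [Matrix.matrix_eq_sum_single M]
  rw [map_sum]
  refine Finset.sum_congr rfl fun i _ => ?_
  rw [map_sum]
  refine Finset.sum_congr rfl fun j _ => ?_
  have : Matrix.single i j (M i j) = M i j • Matrix.single i j (1 : ℝ) := by
    rw [Matrix.smul_single, smul_eq_mul, mul_one]
  rw [this, map_smul, smul_eq_mul, mul_comm]
  rfl

theorem blockHess_smul (f : MatTuple m n → ℝ) (l : Fin L) (X : MatTuple m n) (t : ℝ)
    (H : Matrix (Fin (m l)) (Fin (n l)) ℝ) :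
    blockHess f l X (t • H) = t ^ 2 * blockHess f l X H := by
  have : (Pi.single l (t • H) : MatTuple m n) = t • Pi.single l H := by
    funext l'
    rcases eq_or_ne l' l with rfl | hl'
    · simp
    · simp [Pi.single_eq_of_ne hl']
  rw [blockHess, blockHess, this, iteratedFDeriv_two_apply, iteratedFDeriv_two_apply]
  simp only [Matrix.cons_val_zero, Matrix.cons_val_one, map_smul, _root_.smul_apply,
    smul_eq_mul]
  ring

theorem frobInner_mul_transpose_left {p q k : ℕ} (G : Matrix (Fin p) (Fin q) ℝ)
    (M : Matrix (Fin p) (Fin k) ℝ) (B : Matrix (Fin q) (Fin k) ℝ) :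
    frobInner G (M * Bᵀ) = frobInner (G * B) M := by
  rw [frobInner, frobInner, transpose_mul, ← Matrix.mul_assoc, Matrix.trace_mul_comm,
    Matrix.mul_assoc]

theorem frobInner_mul_transpose_right {p q k : ℕ} (G : Matrix (Fin p) (Fin q) ℝ)
    (A : Matrix (Fin p) (Fin k) ℝ) (M : Matrix (Fin q) (Fin k) ℝ) :
    frobInner G (A * Mᵀ) = frobInner (Gᵀ * A) M := by
  rw [frobInner, frobInner, ← Matrix.mul_assoc, ← Matrix.trace_transpose, transpose_mul,
    transpose_transpose, Matrix.trace_mul_comm]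

theorem eq_neg_smul_of_frobInner {p q : ℕ} {M N : Matrix (Fin p) (Fin q) ℝ} {c : ℝ}
    (h : ∀ K, 0 = frobInner M K + c * frobInner N K) : M = -(c • N) := by
  have h1 := h (M + c • N)
  rw [← frobInner_smul_left, ← frobInner_add_left, ← norm_sq_eq_frobInner] at h1
  exact eq_neg_of_add_eq_zero_left (norm_eq_zero.mp (pow_eq_zero_iff two_ne_zero |>.mp h1.symm))

theorem IsSOSP.block {f : MatTuple m n → ℝ} (hf : ContDiff ℝ 2 f) {lam : ℝ}
    {A : MatTuple m fun _ => r} {B : MatTuple n fun _ => r}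
    (h : IsSOSP (regLoraLoss f lam r) (A, B)) (l : Fin L) :
    blockGrad f l (lowRankProd A B) * B l = -(lam • A l) ∧
    (blockGrad f l (lowRankProd A B))ᵀ * A l = -(lam • B l) ∧
    ∀ (dA : Matrix (Fin (m l)) (Fin r) ℝ) (dB : Matrix (Fin (n l)) (Fin r) ℝ),
      0 ≤ 2 * frobInner (blockGrad f l (lowRankProd A B)) (dA * dBᵀ) +
        blockHess f l (lowRankProd A B) (dA * (B l)ᵀ + A l * dBᵀ) +
        lam * (‖dA‖ ^ 2 + ‖dB‖ ^ 2) := by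
  have key := fun dA dB => fderiv_and_iteratedFDeriv_of_quadratic_curve
    (contDiff_regLoraLoss hf lam) hf (regLoraLoss_line f lam A B l dA dB)
  have h1 : ∀ dA dB, 0 = frobInner (blockGrad f l (lowRankProd A B) * B l) dA +
      frobInner ((blockGrad f l (lowRankProd A B))ᵀ * A l) dB +
      lam * (frobInner (A l) dA + frobInner (B l) dB) := fun dA dB => by
    have h2 := fderiv_single f (lowRankProd A B) l (dA * (B l)ᵀ + A l * dBᵀ)
    rw [frobInner_add_right, frobInner_mul_transpose_left, frobInner_mul_transpose_right] at h2
    have h3 := (key dA dB).1.trans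
      (congrArg (· + lam * (frobInner (A l) dA + frobInner (B l) dB)) h2)
    rw [h.1] at h3
    exact h3
  refine ⟨eq_neg_smul_of_frobInner fun K => ?_, eq_neg_smul_of_frobInner fun K => ?_,
    fun dA dB => ?_⟩
  · have := h1 K 0
    simp only [frobInner, Matrix.mul_zero, Matrix.trace_zero, add_zero] at this
    exact this
  · have := h1 0 K
    simp only [frobInner, Matrix.mul_zero, Matrix.trace_zero, zero_add] at this
    exact this
  · have := h.2 (Pi.single l dA, Pi.single l dB)
    have h2 := (key dA dB).2.trans (congrArg (fun z =>
      blockHess f l (lowRankProd A B) (dA * (B l)ᵀ + A l * dBᵀ) + 2 * z +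
        2 * (lam / 2 * (‖dA‖ ^ 2 + ‖dB‖ ^ 2))) (fderiv_single f (lowRankProd A B) l (dA * dBᵀ)))
    rw [h2] at this
    linarith

/-- The nuclear norm need not be differentiable, but by convexity it lies below its chord on the
segment from `Xs l` to `Y`. Replacing it by the chord preserves minimality at `t = 0`, and the right
derivative there is nonnegative. -/
theorem IsGlobalMin.neg_le {f : MatTuple m n → ℝ} (hf : Differentiable ℝ f) {lam : ℝ}
    (hlam : 0 ≤ lam) {Xs : MatTuple m n} (h : IsGlobalMin (regFullLoss f lam) Xs) (l : Fin L)
    (Y : Matrix (Fin (m l)) (Fin (n l)) ℝ) :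
    0 ≤ frobInner (blockGrad f l Xs) (Y - Xs l) + lam * (nuclearNorm Y - nuclearNorm (Xs l)) := by
  set H : MatTuple m n := Pi.single l (Y - Xs l) with hH
  set C := lam * (nuclearNorm Y - nuclearNorm (Xs l)) with hC
  have hd : HasDerivAt (fun t : ℝ => f (Xs + t • H) + t * C) (fderiv ℝ f Xs H + C) 0 := by
    have h1 : HasDerivAt (fun t : ℝ => Xs + t • H) H 0 := by
      have := ((hasDerivAt_id (0 : ℝ)).smul_const H).const_add Xs
      rw [one_smul] at this
      exact this
    have h2 : HasFDerivAt f (fderiv ℝ f Xs) (Xs + (0 : ℝ) • H) := by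
      simpa using (hf Xs).hasFDerivAt
    have h3 : HasDerivAt (fun t : ℝ => t * C) C 0 := by
      simpa using (hasDerivAt_id (0 : ℝ)).mul_const C
    exact (h2.comp_hasDerivAt (0 : ℝ) h1).add h3
  have hmin : ∀ t : ℝ, 0 ≤ t → t ≤ 1 → f Xs ≤ f (Xs + t • H) + t * C := by
    intro t ht0 ht1
    have h1 : ∑ l', nuclearNorm ((Xs + t • H) l') ≤
        ∑ l', nuclearNorm (Xs l') + t * (nuclearNorm Y - nuclearNorm (Xs l)) := by
      have h2 : ∀ l', nuclearNorm ((Xs + t • H) l') ≤ nuclearNorm (Xs l') +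
          if l' = l then t * (nuclearNorm Y - nuclearNorm (Xs l)) else 0 := by
        intro l'
        split_ifs with hl
        · subst hl
          have h3 : (Xs + t • H) l' = (1 - t) • Xs l' + t • Y := by
            simp only [hH, Pi.add_apply, Pi.smul_apply, Pi.single_eq_same, smul_sub, sub_smul,
              one_smul]
            abel
          have h4 := nuclearNorm_smul_add_smul_le (Xs l') Y (sub_nonneg.mpr ht1) ht0
          rw [h3]
          linarith
        · simp [hH, Pi.single_eq_of_ne hl]
      refine (Finset.sum_le_sum fun l' _ => h2 l').trans_eq ?_
      rw [Finset.sum_add_distrib, Finset.sum_ite_eq' Finset.univ l, if_pos (Finset.mem_univ l)]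
    have h2 := h (Xs + t • H)
    simp only [regFullLoss] at h2
    have h3 := mul_le_mul_of_nonneg_left h1 hlam
    rw [hC]
    linarith
  have hslope := (hasDerivWithinAt_iff_tendsto_slope' (by simp : (0 : ℝ) ∉ Set.Ioi 0)).mp
    (hd.hasDerivWithinAt (s := Set.Ioi 0))
  rw [← fderiv_single]
  refine ge_of_tendsto hslope ?_
  filter_upwards [Ioo_mem_nhdsGT (zero_lt_one' ℝ)] with t ht
  rw [slope_def_field]
  have := hmin t ht.1.le ht.2.le
  refine div_nonneg ?_ (by linarith [ht.1])
  simp only [zero_smul, add_zero, zero_mul]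
  linarith

end Calculus

section Estimates

/-! ### Quantitative estimates -/

theorem rank_sub_le_add {p q : ℕ} (X Y : Matrix (Fin p) (Fin q) ℝ) :
    (X - Y).rank ≤ X.rank + Y.rank := by
  rw [Matrix.rank, Matrix.rank, Matrix.rank]
  refine le_trans (Submodule.finrank_mono ?_)
    (Submodule.finrank_add_le_finrank_add_finrank X.mulVecLin.range Y.mulVecLin.range)
  rintro _ ⟨w, rfl⟩
  rw [Matrix.mulVecLin_apply, sub_mulVec]
  exact Submodule.sub_mem_sup ⟨w, rfl⟩ ⟨w, rfl⟩

/-- Plays the upper bound `α d² ≤ β σ_r ⟨E, Xs⟩` against the lower bound `norm_sub_sq_ge` for `Y`.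
`T` and `D` bound `X` and the distance, and `S` bounds the error of trading `Xs` for `Y` inside `⟨E,
·⟩`; the hypothesis on `δ` absorbs all resulting errors into `ε³`. -/
theorem estimates_of_rank_eq {p q r s : ℕ} {X Xs Y E : Matrix (Fin p) (Fin q) ℝ}
    {v : Fin q → Fin q → ℝ} {α β δ ε D T S : ℝ} (hv : IsRightSingularBasis X v)
    (hrank : X.rank = r) (hr : 0 < r) (hE : OpLe E 1)
    (hEv : ∀ j : Fin q, sval X (j + 1) ≠ 0 → E *ᵥ v j = 0) (hXE : Xᵀ * E = 0) (hα : 0 < α)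
    (hαE : α * ‖X - Xs‖ ^ 2 ≤ max β 0 * sval X r * frobInner E Xs) (hY : ‖Y - Xs‖ ≤ δ)
    (hYs : Y.rank ≤ s) (hsr : s ≤ r) (hD : ‖X - Xs‖ ≤ D) (hT : ‖X‖ ≤ T) (hS : √(q : ℝ) ≤ S)
    (hε0 : 0 < ε) (hε1 : ε < 1) (hδ : (2 * D + 4 + 2 * (T + 1) * S) * δ ≤ ε ^ 3)
    (hd : ε < ‖X - Xs‖) :
    2 * α < β * (1 + ε) ∧
      max (2 * α / (β * (1 + ε)) * sval X s) (α / (2 * β * √(r : ℝ)) * ε) ≤ sval X r ∧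
      (sval X r ≤ 2 * α / β * sval X s ∨
        ∃ P, IsRankProj s X P ∧
          √((‖X - P‖ ^ 2 - ε ^ 3) / (1 - 2 * α * sval X s / (β * sval X r))) - ε ^ 2
            ≤ ‖X - Xs‖) := by
  obtain ⟨P, hP, hPn⟩ := hv.exists_isRankProj s
  have hσ : 0 < sval X r := by
    obtain ⟨k, rfl⟩ := Nat.exists_eq_add_of_le' hr
    exact (sval_succ_pos_iff X k).mpr (by omega)
  have hKF := hv.norm_sub_sq_ge hE hEv hXE hYs
  rw [← hPn] at hKF
  have hσT : sval X r ≤ T := (sval_le_norm X r).trans hT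
  have hσsT : sval X s ≤ T := (sval_le_norm X s).trans hT
  have hσs := sval_nonneg X s
  have hss : 1 ≤ s → sval X r ≤ sval X s := fun h => sval_le_sval X h hsr
  set d := ‖X - Xs‖ with hd_def
  set σ := sval X r
  set σs := sval X s
  have hδ0 : 0 ≤ δ := (norm_nonneg _).trans hY
  have hS0 : 0 ≤ S := (Real.sqrt_nonneg _).trans hS
  have hd0 : 0 < d := hε0.trans hd
  have hT0 : 0 ≤ T := hσ.le.trans hσT
  have hD0 : 0 ≤ D := hd0.le.trans hD
  have hTS := mul_nonneg hT0 hS0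
  have hδS := mul_nonneg hδ0 hS0
  have hDδ := mul_nonneg hD0 hδ0
  have hTSδ := mul_nonneg hTS hδ0
  have hε3 : ε ^ 3 ≤ ε := by
    simpa using pow_le_pow_of_le_one hε0.le hε1.le (show 1 ≤ 3 by norm_num)
  have hδ' : 2 * (D * δ) + 4 * δ + 2 * (T * S * δ) + 2 * (δ * S) ≤ ε ^ 3 := by linarith
  have hδε : 4 * δ + 2 * (δ * S) ≤ ε := by linarith
  -- For `β ≤ 0` the upper bound reads `α d² ≤ 0`, contradicting `d > ε`.
  have hβ : 0 < β := by
    by_contra h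
    rw [max_eq_right (not_lt.mp h)] at hαE
    have := mul_pos hα (pow_pos hd0 2)
    linarith
  rw [max_eq_left hβ.le] at hαE
  have hXE0 : frobInner E X = 0 := by rw [frobInner_comm, frobInner, hXE, Matrix.trace_zero]
  have he : frobInner E Xs ≤ frobInner E Y + S * δ := by
    have h1 := hE.frobInner_le_of_rank_le (M := Xs - Y) (rank_le_width _)
    rw [frobInner_sub_right, norm_sub_rev] at h1
    have h2 := mul_le_mul hS hY (norm_nonneg _) hS0
    linarith
  have hdY : ‖X - Y‖ ≤ d + δ := by
    have h1 : X - Y = (X - Xs) - (Y - Xs) := by abel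
    rw [h1]
    exact (norm_sub_le _ _).trans (add_le_add_right hY _)
  have hdYsq : ‖X - Y‖ ^ 2 ≤ (d + δ) ^ 2 := pow_le_pow_left₀ (norm_nonneg _) hdY 2
  have heY : frobInner E Y ≤ √((2 * r : ℕ) : ℝ) * (d + δ) := by
    have h1 := hE.frobInner_le_of_rank_le (M := Y - X) (k := 2 * r)
      ((rank_sub_le_add Y X).trans (by omega))
    rw [frobInner_sub_right, hXE0, sub_zero, norm_sub_rev] at h1
    exact h1.trans (mul_le_mul_of_nonneg_left hdY (Real.sqrt_nonneg _))
  have hβσ : 0 < β * σ := mul_pos hβ hσ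
  have hα2 : α * d ^ 2 ≤ β * σ * (frobInner E Y + S * δ) :=
    hαE.trans (mul_le_mul_of_nonneg_left he hβσ.le)
  set c := 2 * α * σs / (β * σ) with hc
  have hcd : c * d ^ 2 ≤ 2 * σs * (frobInner E Y + S * δ) := by
    have h1 : c * d ^ 2 = 2 * σs / (β * σ) * (α * d ^ 2) := by rw [hc]; field_simp
    have h2 : 2 * σs * (frobInner E Y + S * δ) =
        2 * σs / (β * σ) * (β * σ * (frobInner E Y + S * δ)) := by field_simp
    rw [h1, h2]
    exact mul_le_mul_of_nonneg_left hα2 (by positivity)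
  have hmain : ‖X - P‖ ^ 2 - ε ^ 3 ≤ (1 - c) * d ^ 2 := by
    have h1 : 2 * d * δ + δ ^ 2 + 2 * σs * (S * δ) ≤ ε ^ 3 := by
      have e1 : d * δ ≤ D * δ := mul_le_mul_of_nonneg_right hD hδ0
      have e2 : σs * (S * δ) ≤ T * (S * δ) := mul_le_mul_of_nonneg_right hσsT (by positivity)
      have e3 : δ * δ ≤ 1 * δ := mul_le_mul_of_nonneg_right (by linarith) hδ0
      have e4 : δ ^ 2 = δ * δ := pow_two δ
      linarith
    have h2 : (d + δ) ^ 2 = d ^ 2 + (2 * d * δ + δ ^ 2) := by ring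
    have h3 : (1 - c) * d ^ 2 = d ^ 2 - c * d ^ 2 := by ring
    rw [h2] at hdYsq
    linarith
  -- Otherwise `(c - 1) d² ≥ ε d² > ε³`, while `hmain` bounds `(c - 1) d²` by `ε³`.
  have hcε : c < 1 + ε := by
    by_contra hcon
    have h1 : ε * d ^ 2 ≤ (c - 1) * d ^ 2 :=
      mul_le_mul_of_nonneg_right (by linarith) (sq_nonneg d)
    have h2 : ε * ε ^ 2 < ε * d ^ 2 :=
      mul_lt_mul_of_pos_left (pow_lt_pow_left₀ hd hε0.le two_ne_zero) hε0
    have h3 : ε * ε ^ 2 = ε ^ 3 := by ring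
    linarith [sq_nonneg ‖X - P‖]
  have hcmul : 2 * α * σs < (1 + ε) * (β * σ) := (div_lt_iff₀ hβσ).mp hcε
  refine ⟨?_, max_le ?_ ?_, ?_⟩
  -- For `s = 0` the convention `σ₀ = 0` makes `c = 0`, so `hcε` carries no information. Instead `Y`
  -- has rank zero, the correlation is at most zero, and `d²` is bounded by the error terms alone.
  · rcases Nat.eq_zero_or_pos s with hs | hs
    · by_contra hcon
      have h1 : frobInner E Y ≤ 0 := by
        have := hE.frobInner_le_of_rank_le hYs
        rw [hs, Nat.cast_zero, Real.sqrt_zero, zero_mul] at this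
        exact this
      have h2 : α * d ^ 2 ≤ β * (σ * (S * δ)) := by
        refine hα2.trans ?_
        rw [mul_assoc]
        refine mul_le_mul_of_nonneg_left (mul_le_mul_of_nonneg_left ?_ hσ.le) hβ.le
        linarith
      have h3 : β ≤ 2 * α := by
        have := mul_pos hβ hε0
        linarith
      have h4 : α * d ^ 2 ≤ α * (2 * (T * (S * δ))) := by
        have e1 : σ * (S * δ) ≤ T * (S * δ) := mul_le_mul_of_nonneg_right hσT (by positivity)
        have e2 : β * (σ * (S * δ)) ≤ 2 * α * (T * (S * δ)) :=
          mul_le_mul h3 e1 (by positivity) (by positivity)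
        linarith
      have h5 := le_of_mul_le_mul_left h4 hα
      have h6 : ε ^ 2 < d ^ 2 := pow_lt_pow_left₀ hd hε0.le two_ne_zero
      have h7 : ε ^ 3 ≤ ε ^ 2 := pow_le_pow_of_le_one hε0.le hε1.le (by norm_num)
      have h8 := mul_nonneg hδ0 hS0
      linarith
    · have h1 := hss hs
      have h2 : 2 * α * σs < β * (1 + ε) * σs := by
        refine hcmul.trans_le ?_
        have := mul_le_mul_of_nonneg_left h1 (by positivity : 0 ≤ β * (1 + ε))
        linarith
      exact lt_of_mul_lt_mul_right h2 hσs
  · rw [div_mul_eq_mul_div, div_le_iff₀ (by positivity)]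
    linarith
  -- `Y - X` has rank at most `2 r`, so `⟨E, Y⟩ ≤ √(2r) (d + δ)`. With `√2 ≤ 3/2`, the remaining `√r
  -- d / 2` absorbs the `δ` terms, leaving `2 √r d`.
  · have hr1 : (1 : ℝ) ≤ √(r : ℝ) := by
      rw [Real.one_le_sqrt]
      exact_mod_cast hr
    have h2r : √((2 * r : ℕ) : ℝ) ≤ 3 / 2 * √(r : ℝ) := by
      push_cast
      rw [Real.sqrt_mul (by norm_num)]
      refine mul_le_mul_of_nonneg_right ?_ (by positivity)
      rw [Real.sqrt_le_left (by norm_num)]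
      norm_num
    have h1 : frobInner E Y + S * δ ≤ 2 * √(r : ℝ) * d := by
      have e1 : √((2 * r : ℕ) : ℝ) * (d + δ) ≤ 3 / 2 * √(r : ℝ) * (d + δ) :=
        mul_le_mul_of_nonneg_right h2r (by positivity)
      have e2 : S * δ ≤ √(r : ℝ) * (S * δ) := le_mul_of_one_le_left (by positivity) hr1
      have e3 : √(r : ℝ) * (3 / 2 * δ + S * δ) ≤ √(r : ℝ) * (1 / 2 * d) :=
        mul_le_mul_of_nonneg_left (by linarith) (by positivity)
      linarith
    have h3 : α * d ^ 2 ≤ β * σ * (2 * √(r : ℝ) * d) :=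
      hα2.trans (mul_le_mul_of_nonneg_left h1 hβσ.le)
    have h4 : d * (α * d) ≤ d * (σ * (2 * β * √(r : ℝ))) := by linarith
    have h5 := le_of_mul_le_mul_left h4 hd0
    rw [div_mul_eq_mul_div, div_le_iff₀ (by positivity)]
    exact (mul_le_mul_of_nonneg_left hd.le hα.le).trans h5
  · by_cases hcase : σ ≤ 2 * α / β * σs
    · exact Or.inl hcase
    · refine Or.inr ⟨P, hP, ?_⟩
      have h1 : c < 1 := by
        rw [hc, div_lt_one hβσ]
        rw [not_le, div_mul_eq_mul_div, div_lt_iff₀ hβ] at hcase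
        linarith
      have h2 : √((‖X - P‖ ^ 2 - ε ^ 3) / (1 - c)) ≤ d := by
        refine Real.sqrt_le_iff.mpr ⟨hd0.le, ?_⟩
        rw [div_le_iff₀ (sub_pos.mpr h1)]
        linarith
      -- The bound holds even before subtracting `ε²`.
      linarith [sq_nonneg ε]

end Estimates

end LoRA

/-! ### Assembly over the layers -/

theorem mainTheorem5 {L : ℕ} (m n : Fin L → ℕ) {𝒳 𝒴 : Type*} (D R : ℝ)
    (δ : ℝ → ℝ) (hδ : δ =o[𝓝[>] (0 : ℝ)] fun ε => ε ^ 3) :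
    ∀ᶠ ε in 𝓝[>] (0 : ℝ),
      ∀ (K N : ℕ) (net : LoRA.MatTuple m n → 𝒳 → EuclideanSpace ℝ (Fin K))
        (W₀ : LoRA.MatTuple m n) (loss : EuclideanSpace ℝ (Fin K) → 𝒴 → ℝ)
        (x : Fin N → 𝒳) (y : Fin N → 𝒴) (f : LoRA.MatTuple m n → ℝ) (lam : ℝ) (r rs : ℕ)
        (Xs Xδ : LoRA.MatTuple m n) (α β : Fin L → ℝ),
        f = LoRA.fullLoss net W₀ loss x y →
        ContDiff ℝ 2 f →
        0 ≤ lam →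
        LoRA.IsGlobalMin (LoRA.regFullLoss f lam) Xs →
        LoRA.tupleNorm Xs ≤ R →
        LoRA.IsApproxGlobalMin (LoRA.regFullLoss f lam) Xs (δ ε) Xδ →
        LoRA.tupleRank Xδ ≤ rs →
        rs ≤ r →
        LoRA.IsRSC f Xs r D α →
        LoRA.IsRSM f Xs r D β →
        (∀ l, 0 < α l) →
        ∀ (A : LoRA.MatTuple m fun _ => r) (B : LoRA.MatTuple n fun _ => r),
          LoRA.IsSOSP (LoRA.regLoraLoss f lam r) (A, B) →
          ∀ X : LoRA.MatTuple m n, X = LoRA.lowRankProd A B →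
          LoRA.tupleNorm (X - Xs) ≤ D →
          ((∀ l, β l * (1 + ε) ≤ 2 * α l) →
            LoRA.IsApproxGlobalMin (LoRA.regFullLoss f lam) Xs ε X) ∧
          ((∃ l, 2 * α l < β l * (1 + ε)) →
            LoRA.IsApproxGlobalMin (LoRA.regFullLoss f lam) Xs ε X ∨
            (¬ LoRA.IsApproxGlobalMin (LoRA.regFullLoss f lam) Xs ε X ∧
              ∃ l, 2 * α l < β l * (1 + ε) ∧
                (X l).rank = r ∧
                max (2 * α l / (β l * (1 + ε)) * LoRA.sval (X l) rs)
                  (α l / (2 * β l * Real.sqrt r) * ε) ≤ LoRA.sval (X l) r ∧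
                (LoRA.sval (X l) r ≤ 2 * α l / β l * LoRA.sval (X l) rs ∨
                  ∃ P, LoRA.IsRankProj rs (X l) P ∧
                    Real.sqrt ((‖X l - P‖ ^ 2 - ε ^ 3) /
                      (1 - 2 * α l * LoRA.sval (X l) rs / (β l * LoRA.sval (X l) r))) - ε ^ 2
                      ≤ ‖X l - Xs l‖))) := by
  set S : ℝ := ∑ l, √(n l : ℝ) with hSdef
  have hS : ∀ l, √(n l : ℝ) ≤ S := fun l =>
    Finset.single_le_sum (f := fun l => √(n l : ℝ)) (fun _ _ => Real.sqrt_nonneg _)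
      (Finset.mem_univ l)
  have hS0 : 0 ≤ S := Finset.sum_nonneg fun _ _ => Real.sqrt_nonneg _
  -- The error constant of `estimates_of_rank_eq` with `D` replaced by `|D|` and `T = |D| + |R|`;
  -- `S` serves every layer at once. It depends only on `n`, `D` and `R`, so the threshold for `ε`
  -- does not depend on `f`, `lam` or the ranks.
  set C : ℝ := 2 * |D| + 4 + 2 * (|D| + |R| + 1) * S with hC
  have hC1 : 1 ≤ C := by
    have := abs_nonneg D
    have : 0 ≤ 2 * (|D| + |R| + 1) * S := by positivity
    linarith
  have hC0 : 0 < C := by linarith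
  filter_upwards [hδ.def (inv_pos.mpr hC0), Ioo_mem_nhdsGT (zero_lt_one' ℝ)] with ε hδε hε
  intro K N net W₀ loss x y f lam r rs Xs Xδ α β _ hf hlam hmin hR hXδ hrs hrsr hRSC hRSM hα A B
    hsosp X hX hD
  obtain ⟨hε0, hε1⟩ := hε
  have hCδ : C * δ ε ≤ ε ^ 3 := by
    rw [Real.norm_eq_abs, Real.norm_eq_abs, abs_of_pos (pow_pos hε0 3)] at hδε
    have h1 := mul_le_mul_of_nonneg_left ((le_abs_self _).trans hδε) hC0.le
    rwa [← mul_assoc, mul_inv_cancel₀ hC0.ne', one_mul] at h1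
  have hrank : ∀ l, (X l).rank ≤ r := fun l => by
    rw [hX]
    exact (Matrix.rank_mul_le_left _ _).trans ((Matrix.rank_le_width _))
  -- Every layer farther than `ε` from the minimizer has all the properties in (ii). In the special
  -- regime its first claim is contradictory, so no such layer exists.
  have hlayer : ∀ l, ε < ‖X l - Xs l‖ → 2 * α l < β l * (1 + ε) ∧ (X l).rank = r ∧
      max (2 * α l / (β l * (1 + ε)) * LoRA.sval (X l) rs)
        (α l / (2 * β l * Real.sqrt r) * ε) ≤ LoRA.sval (X l) r ∧
      (LoRA.sval (X l) r ≤ 2 * α l / β l * LoRA.sval (X l) rs ∨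
        ∃ P, LoRA.IsRankProj rs (X l) P ∧
          Real.sqrt ((‖X l - P‖ ^ 2 - ε ^ 3) /
            (1 - 2 * α l * LoRA.sval (X l) rs / (β l * LoRA.sval (X l) r))) - ε ^ 2
            ≤ ‖X l - Xs l‖) := by
    intro l hd
    have hXD : ‖X l - Xs l‖ ≤ D := (LoRA.norm_le_tupleNorm (X - Xs) l).trans hD
    have hYrank : (Xδ l).rank ≤ rs := (LoRA.rank_le_tupleRank Xδ l).trans hrs
    have htr : LoRA.tupleRank X ≤ r := Finset.sup_le fun l _ => hrank l
    have hrsc := hRSC l X hD htr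
    have hdual := hmin.neg_le (hf.differentiable (by norm_num)) hlam l (X l)
    obtain ⟨hGA, hGB, hso⟩ := hsosp.block hf l
    rw [← hX] at hGA hGB hso
    have hXl : X l = A l * (B l).transpose := by rw [hX]; rfl
    -- Adding first-order optimality of `Xs` cancels the nuclear norms, so a subgradient inequality
    -- at `X` with remainder `z` leaves `z` as a bound on the strong-convexity term.
    have hup : ∀ z : ℝ, LoRA.frobInner (LoRA.blockGrad f l X) (X l - Xs l) ≤
        lam * (LoRA.nuclearNorm (Xs l) - LoRA.nuclearNorm (X l)) + z →
        α l * ‖X l - Xs l‖ ^ 2 ≤ z := fun z hz => by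
      rw [LoRA.frobInner_sub_left] at hrsc
      linarith
    have hpos : 0 < α l * ‖X l - Xs l‖ ^ 2 :=
      mul_pos (hα l) (pow_pos (hε0.trans hd) 2)
    rcases Nat.eq_zero_or_pos r with hr0 | hr0
    -- With `r = 0` both `X l` and `Xδ l` vanish, so the distance is at most `δ ε ≤ ε³ ≤ ε`, using
    -- `C ≥ 1`.
    · exfalso
      have h1 : X l = 0 := LoRA.eq_zero_of_rank_eq_zero (by have := hrank l; omega)
      have h2 : Xδ l = 0 := LoRA.eq_zero_of_rank_eq_zero (by omega)
      have h3 := hXδ.2 l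
      rw [h2] at h3
      rw [h1] at hd
      have h4 : ε ^ 3 ≤ ε := by
        simpa using pow_le_pow_of_le_one hε0.le hε1.le (show 1 ≤ 3 by norm_num)
      have h5 : ε < δ ε := hd.trans_le h3
      have h6 : 1 * δ ε ≤ C * δ ε := mul_le_mul_of_nonneg_right hC1 (hε0.trans h5).le
      linarith
    rcases (hrank l).lt_or_eq with hlt | heq
    · exfalso
      have h1 := LoRA.frobInner_grad_sub_le_of_rank_lt hlam hGA hGB hXl
        (LoRA.blockHess_smul f l X) hso hlt (Xs l)
      have := hup 0 (by rwa [add_zero])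
      linarith
    · obtain ⟨v, hv⟩ := LoRA.exists_isRightSingularBasis (X l)
      obtain ⟨E, hE, hEv, hXE, hG⟩ := LoRA.exists_contraction_of_rank_eq hlam hGA hGB hXl hso
        (hRSM l X hD htr) hv hr0 heq
      have hXs : ‖Xs l‖ ≤ |R| := (LoRA.norm_le_tupleNorm Xs l).trans (hR.trans (le_abs_self R))
      have hXT : ‖X l‖ ≤ |D| + |R| := by
        have h1 : X l = (X l - Xs l) + Xs l := by abel
        rw [h1]
        exact (norm_add_le _ _).trans (add_le_add (hXD.trans (le_abs_self D)) hXs)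
      have h1 := LoRA.estimates_of_rank_eq hv heq hr0 hE hEv hXE (hα l) (hup _ (hG (Xs l)))
        (hXδ.2 l) hYrank hrsr (hXD.trans (le_abs_self D)) hXT (hS l) hε0 hε1 hCδ hd
      exact ⟨h1.1, heq, h1.2⟩
  refine ⟨fun h => ⟨hmin, fun l => ?_⟩, fun _ => ?_⟩
  · by_contra hcon
    exact absurd (hlayer l (not_le.mp hcon)).1 (not_lt.mpr (h l))
  · by_cases hgm : LoRA.IsApproxGlobalMin (LoRA.regFullLoss f lam) Xs ε X
    · exact Or.inl hgm
    · refine Or.inr ⟨hgm, ?_⟩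
      have : ∃ l, ε < ‖X l - Xs l‖ := by
        by_contra! hcon
        exact hgm ⟨hmin, hcon⟩
      obtain ⟨l, hl⟩ := this
      exact ⟨l, hlayer l hl⟩
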